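/- Let $\mathbb K$ be $\mathbb R$ or $\mathbb C$. Let $\mathbf I$ be a real symmetric positive definite $3\times3$ matrix (the tensor of inertia), $m>0$, $g\in\mathbb R$ and $\mathbf L\in\mathbb R^3$. For $\mathbf X=(\mathbf M,\boldsymbol\Gamma)\in\mathbb K^3\times\mathbb K^3$ put \[ \mathbf J(\boldsymbol\Gamma)=\mathbf I+m(\mathbf L\times\boldsymbol\Gamma)(\mathbf L\times\boldsymbol\Gamma)^T,\qquad \boldsymbol\Omega=\mathbf J(\boldsymbol\Gamma)^{-1}\mathbf M, \] \[ H=\tfrac12\,\boldsymbol\Omega\cdot\mathbf I\boldsymbol\Omega+\tfrac12 m\,[\boldsymbol\Gamma\cdot(\boldsymbol\Omega\times\mathbf L)]^2+mg\,\boldsymbol\Gamma\cdot\mathbf L,\qquad F_1=\boldsymbol\Gamma\cdot\boldsymbol\Gamma,\qquad F_2=\boldsymbol\Gamma\cdot\mathbf M, \] \[ H_2=\tfrac12\,\mathbf M\cdot\mathbf I^{-1}\mathbf M+mg\,\boldsymbol\Gamma\cdot\mathbf L . \] Here $\cdot$ is the bilinear dot product, and $H$ is considered where $\det\mathbf J(\boldsymbol\Gamma)\neq0$.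 The sliding top is the Hamiltonian system \[ \dot{\mathbf M}=\mathbf M\times\frac{\partial H}{\partial\mathbf M}+\boldsymbol\Gamma\times\frac{\partial H}{\partial\boldsymbol\Gamma},\qquad \dot{\boldsymbol\Gamma}=\boldsymbol\Gamma\times\frac{\partial H}{\partial\mathbf M}, \] and the classical heavy top is given by the Euler--Poisson equations \[ \dot{\mathbf M}=\mathbf M\times\mathbf I^{-1}\mathbf M-mg\,\mathbf L\times\boldsymbol\Gamma,\qquad \dot{\boldsymbol\Gamma}=\boldsymbol\Gamma\times\mathbf I^{-1}\mathbf M . \] The sliding top has the first integrals $H,F_1,F_2$, and the heavy top has the first integrals $H_2,F_1,F_2$. Either system is called integrable with meromorphic first integrals on an open set $D\subseteq\mathbb K^6$ if it has on $D$ one more first integral that is meromorphic (locally a quotient of two $\mathbb K$-analytic functions) and functionally independent of these three, i.e. the four differentials are linearly independent on a dense subset of $D$. Lemma. Let $D\subseteq\mathbb K^6$ be open with $0\in D$ and $\det\mathbf J(\boldsymbol\Gamma)\ne0$ on $D$ (for instance $D=\{\det\mathbf J(\boldsymbol\Gamma)\neq0\}$, the whole domain of the system, or any smaller neighbourhood of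 the origin). If the sliding top is integrable with meromorphic first integrals on $D$, then the classical heavy top with the same $\mathbf I,m,g,\mathbf L$ is integrable with meromorphic first integrals on $\mathbb K^6$. -/

import Mathlib

open scoped Matrix Topology

noncomputable section

namespace SlidingTop

/-- The phase space `𝕜³ × 𝕜³` of pairs `X = (M, Γ)` (real for `𝕜 = ℝ`, complexified for `𝕜 = ℂ`). -/
abbrev Phase (𝕜 : Type*) : Type _ := (Fin 3 → 𝕜) × (Fin 3 → 𝕜)

/-- A rigid body in a constant gravity field: its tensor of inertia with respect to the centre of
mass, its mass, the gravitational acceleration (zero is allowed), and the constant vector `L` from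
the distinguished point of the body to its centre of mass, in the body frame. -/
structure Body where
  inertia : Matrix (Fin 3) (Fin 3) ℝ
  inertia_posDef : inertia.PosDef
  mass : ℝ
  mass_pos : 0 < mass
  grav : ℝ
  L : Fin 3 → ℝ

section General

variable {𝕜 : Type*} [RCLike 𝕜]

/-- `f` is meromorphic on `D ⊆ 𝕜⁶`: near every point of `D` it is a quotient of two analytic
functions, the denominator not vanishing identically near the point. Values of `f` at zeros of the
denominator are irrelevant. -/
def IsMeromorphicOn (f : Phase 𝕜 → 𝕜) (D : Set (Phase 𝕜)) : Prop :=
  ∀ x ∈ D, ∃ P Q : Phase 𝕜 → 𝕜, AnalyticAt 𝕜 P x ∧ AnalyticAt 𝕜 Q x ∧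
    (∃ᶠ y in 𝓝 x, Q y ≠ 0) ∧ ∀ᶠ y in 𝓝 x, Q y ≠ 0 → f y = P y / Q y

/-- `f` is constant along the vector field `V` on `D`: its derivative along `V` vanishes wherever
`f` is analytic. -/
def IsFirstIntegralOn (V : Phase 𝕜 → Phase 𝕜) (f : Phase 𝕜 → 𝕜) (D : Set (Phase 𝕜)) : Prop :=
  ∀ x ∈ D, AnalyticAt 𝕜 f x → fderiv 𝕜 f x (V x) = 0

/-- Functional independence on `D`: the differentials are defined and linearly independent on a
dense subset of `D`. -/
def FunctionallyIndependentOn {ι : Type*} (f : ι → Phase 𝕜 → 𝕜) (D : Set (Phase 𝕜)) : Prop :=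
  D ⊆ closure {x | x ∈ D ∧ (∀ i, AnalyticAt 𝕜 (f i) x) ∧
    LinearIndependent 𝕜 (fun i => fderiv 𝕜 (f i) x)}

/-- The partial gradient `∂H/∂M`. -/
def gradM (H : Phase 𝕜 → 𝕜) (X : Phase 𝕜) : Fin 3 → 𝕜 :=
  fun i => fderiv 𝕜 H X (Pi.single i 1, 0)

/-- The partial gradient `∂H/∂Γ`. -/
def gradΓ (H : Phase 𝕜 → 𝕜) (X : Phase 𝕜) : Fin 3 → 𝕜 :=
  fun i => fderiv 𝕜 H X (0, Pi.single i 1)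

/-- The Hamiltonian vector field of `H` for the Lie-Poisson structure of `e(3)`, whose matrix has
the blocks `[[M̂, Γ̂], [Γ̂, 0]]`, where `Ẑ v = Z × v`. -/
def hamiltonianField (H : Phase 𝕜 → 𝕜) (X : Phase 𝕜) : Phase 𝕜 :=
  (X.1 ⨯₃ gradM H X + X.2 ⨯₃ gradΓ H X, X.2 ⨯₃ gradM H X)

/-- The Casimir function `F₁ = Γ · Γ`. -/
def F₁ (X : Phase 𝕜) : 𝕜 := X.2 ⬝ᵥ X.2

/-- The Casimir function `F₂ = Γ · M`. -/
def F₂ (X : Phase 𝕜) : 𝕜 := X.2 ⬝ᵥ X.1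

/-- The system `X' = V X`, which has the first integrals `H`, `F₁`, `F₂`, is integrable on `D` with
meromorphic first integrals: it has one more meromorphic first integral on `D`, functionally
independent of `H`, `F₁` and `F₂`. -/
def IsIntegrableOn (V : Phase 𝕜 → Phase 𝕜) (H : Phase 𝕜 → 𝕜) (D : Set (Phase 𝕜)) : Prop :=
  ∃ F : Phase 𝕜 → 𝕜, IsMeromorphicOn F D ∧ IsFirstIntegralOn V F D ∧
    FunctionallyIndependentOn ![H, F₁, F₂, F] D

end General

namespace Body

variable (𝕜 : Type*) [RCLike 𝕜] (b : Body)

/-- The tensor of inertia as a matrix over `𝕜`. -/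
def inertiaK : Matrix (Fin 3) (Fin 3) 𝕜 := b.inertia.map (fun r : ℝ => (r : 𝕜))

/-- The vector `L` over `𝕜`. -/
def LK : Fin 3 → 𝕜 := fun i => (b.L i : 𝕜)

variable {𝕜}

/-- The matrix `J(Γ) = I + m (L × Γ) ⊗ (L × Γ)`. -/
def J (Γ : Fin 3 → 𝕜) : Matrix (Fin 3) (Fin 3) 𝕜 :=
  b.inertiaK 𝕜 + (b.mass : 𝕜) • Matrix.vecMulVec (b.LK 𝕜 ⨯₃ Γ) (b.LK 𝕜 ⨯₃ Γ)

/-- The angular velocity `Ω = J(Γ)⁻¹ M` of the sliding top. -/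
def slidingΩ (X : Phase 𝕜) : Fin 3 → 𝕜 := (b.J X.2)⁻¹ *ᵥ X.1

/-- The Hamiltonian of the sliding top. -/
def slidingH (X : Phase 𝕜) : 𝕜 :=
  1 / 2 * (b.slidingΩ X ⬝ᵥ (b.inertiaK 𝕜 *ᵥ b.slidingΩ X))
    + 1 / 2 * (b.mass : 𝕜) * (X.2 ⬝ᵥ (b.slidingΩ X ⨯₃ b.LK 𝕜)) ^ 2
    + (b.mass : 𝕜) * (b.grav : 𝕜) * (X.2 ⬝ᵥ b.LK 𝕜)

/-- The right-hand side of the equations of motion of the sliding top. -/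
def slidingField (X : Phase 𝕜) : Phase 𝕜 := hamiltonianField b.slidingH X

variable (𝕜) in
/-- The set of those `(M, Γ)` at which the equations of the sliding top are defined, that is, at
which `J(Γ)` is invertible. -/
def slidingDomain : Set (Phase 𝕜) := {X | IsUnit (b.J X.2).det}

/-- The Hamiltonian `H₂` of the classical heavy top. -/
def heavyH (X : Phase 𝕜) : 𝕜 :=
  1 / 2 * (X.1 ⬝ᵥ ((b.inertiaK 𝕜)⁻¹ *ᵥ X.1))
    + (b.mass : 𝕜) * (b.grav : 𝕜) * (X.2 ⬝ᵥ b.LK 𝕜)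

/-- The right-hand side of the Euler-Poisson equations of the classical heavy top. -/
def heavyField (X : Phase 𝕜) : Phase 𝕜 :=
  (X.1 ⨯₃ ((b.inertiaK 𝕜)⁻¹ *ᵥ X.1) - ((b.mass : 𝕜) * (b.grav : 𝕜)) • (b.LK 𝕜 ⨯₃ X.2),
    X.2 ⨯₃ ((b.inertiaK 𝕜)⁻¹ *ᵥ X.1))

end Body

end SlidingTop

end

/-! The dilation `(M, Γ) ↦ (ε M, ε² Γ)` makes the sliding top a deformation of the heavy top. Since
`J(ε² Γ) = I + O(ε⁴)`, the sliding Hamiltonian becomes `ε² (H₂ + …)`, while `F₁` and `F₂` acquire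
the factors `ε⁴` and `ε³`. Write the extra integral near the origin as `P / Q` and expand `P` and
`Q` in powers of `ε`. All coefficients are polynomials in `(M, Γ)`, so the leading coefficient of
the quotient is a rational first integral of the heavy top. Being rational, it lives on all of `𝕜⁶`,
although only a neighbourhood of `0` was used.

The difficulty is that this leading coefficient may depend on `H₂, F₁, F₂`. It is removed by
Ziglin's descent, `exists_independent_leading_coeff`, in the power series ring over the field `L` of
rational functions. Three derivations act there: `T`, the weighted Euler derivation, which kills
every expansion; `V`, differentiation along the rescaled Hamiltonian field; and `D`, a Jacobian
minor whose first three rows are the gradients of `H, F₁, F₂`. The integrals are normalised to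
weight zero: `r₁ = F₁ / H²`, `r₂ = F₂² / H³`, `z = P² H^b / Q²`, with `b` the order of `Q`. If the
leading coefficient of `z` is dependent, contraction with the Euler field shows that it depends on
those of `r₁, r₂` alone. By the Jacobian criterion it is then a simple root of a polynomial relation
`R`. The series `u = R(r₁, r₂, z)` has some order `k > 0`, and `u² / H^k` is again an integral of
weight zero, for which the order of `D z` is smaller by `k`. The descent therefore stops.

The analytic side is carried by `HasExpansion`: expansions are unique, compatible with products and
partial derivatives, and zero only for germs that are zero. Hence the equation of a first integral
and the nonvanishing of a Jacobian minor pass to formal series; `isIntegrableOn_of_rational` leads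
back from rational functions to integrability. -/

noncomputable section

namespace SlidingTop

/-! ### Derivations, algebraic dependence and the Jacobian criterion -/

section Formal

/-- The derivation of a power series ring that acts on coefficients. -/
def coeffwise {K A : Type*} [CommRing K] [CommRing A] [Algebra K A] (δ : Derivation K A A) :
    Derivation K (PowerSeries A) (PowerSeries A) :=
  Derivation.mk'
    { toFun := fun f => PowerSeries.mk fun n => δ (PowerSeries.coeff n f)
      map_add' := fun f g => by ext n; simp
      map_smul' := fun c f => by ext n; simp }
    (fun f g => by
      ext n
      simp only [LinearMap.coe_mk, AddHom.coe_mk, PowerSeries.coeff_mk, PowerSeries.coeff_mul,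
        map_sum, Derivation.leibniz, smul_eq_mul, map_add, Finset.sum_add_distrib]
      congr 1
      rw [← Finset.Nat.sum_antidiagonal_swap]
      simp)

@[simp]
lemma coeff_coeffwise {K A : Type*} [CommRing K] [CommRing A] [Algebra K A]
    (δ : Derivation K A A) (f : PowerSeries A) (n : ℕ) :
    PowerSeries.coeff n (coeffwise δ f) = δ (PowerSeries.coeff n f) := by
  simp [coeffwise, Derivation.mk']

/-- The chain rule for a derivation and a polynomial in several variables. -/
lemma derivation_mvPolynomial_aeval {K B σ : Type*} [CommRing K] [CommRing B] [Algebra K B]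
    [Fintype σ] (δ : Derivation K B B) (y : σ → B) (P : MvPolynomial σ K) :
    δ (MvPolynomial.aeval y P)
      = ∑ j, MvPolynomial.aeval y (MvPolynomial.pderiv j P) * δ (y j) := by
  classical
  induction P using MvPolynomial.induction_on with
  | C a => simp
  | add p q hp hq => simp [hp, hq, add_mul, Finset.sum_add_distrib]
  | mul_X p i hp =>
    simp only [map_mul, MvPolynomial.aeval_X, Derivation.leibniz, hp, smul_eq_mul, map_add,
      add_mul, Finset.sum_add_distrib, MvPolynomial.pderiv_X]
    rw [Finset.sum_eq_single (f := fun j => MvPolynomial.aeval y p *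
      MvPolynomial.aeval y (Pi.single (M := fun _ => MvPolynomial σ K) j 1 i) * δ (y j)) i]
    · simp only [Pi.single_eq_same, map_one, Finset.mul_sum, mul_one]
      congr 1
      exact Finset.sum_congr rfl fun j _ => by ring
    · intro j _ hj
      simp [Pi.single_eq_of_ne' hj]
    · simp

/-- A monomial `m` of the derivative can only come from the monomial `m + e_i` of `P`. The strict
drop drives the minimality argument for algebraic relations. -/
lemma totalDegree_pderiv_lt {K σ : Type*} [Field K] (i : σ) (P : MvPolynomial σ K)
    (h : MvPolynomial.pderiv i P ≠ 0) :
    (MvPolynomial.pderiv i P).totalDegree < P.totalDegree := by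
  classical
  obtain ⟨m, hm, hmd⟩ := Finset.exists_mem_eq_sup (MvPolynomial.pderiv i P).support
    (MvPolynomial.support_nonempty.2 h) (fun s => s.sum fun _ e => e)
  have hm' := MvPolynomial.mem_support_iff.1 hm
  rw [MvPolynomial.coeff_pderiv] at hm'
  have hc : MvPolynomial.coeff (m + Finsupp.single i 1) P ≠ 0 := fun h0 => hm' (by simp [h0])
  have := MvPolynomial.le_totalDegree (MvPolynomial.mem_support_iff.2 hc)
  have h2 : (MvPolynomial.pderiv i P).totalDegree = m.sum fun _ e => e := hmd
  rw [h2]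
  have h3 : ((m + Finsupp.single i 1).sum fun _ e => e) = (m.sum fun _ e => e) + 1 := by
    rw [Finsupp.sum_add_index'] <;> simp
  omega

lemma eq_C_of_pderiv_eq_zero {K σ : Type*} [Field K] [CharZero K] (P : MvPolynomial σ K)
    (h : ∀ i, MvPolynomial.pderiv i P = 0) : P = MvPolynomial.C (MvPolynomial.coeff 0 P) := by
  classical
  ext m
  rw [MvPolynomial.coeff_C]
  split_ifs with hm
  · rw [hm]
  · obtain ⟨i, hi⟩ : ∃ i, m i ≠ 0 := by
      by_contra! hc
      exact hm (by ext i; simp [hc i])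
    have h1 := congrArg (MvPolynomial.coeff (m - Finsupp.single i 1)) (h i)
    rw [MvPolynomial.coeff_pderiv] at h1
    have h2 : m - Finsupp.single i 1 + Finsupp.single i 1 = m :=
      tsub_add_cancel_of_le (by
        intro j
        rcases eq_or_ne i j with rfl | hj
        · simpa using Nat.one_le_iff_ne_zero.2 hi
        · simp [hj])
    rw [h2] at h1
    rw [MvPolynomial.coeff_zero] at h1
    rcases mul_eq_zero.1 h1 with h3 | h3
    · exact h3
    · exact absurd h3 (Nat.cast_add_one_ne_zero _)

/-- An algebraic dependence can be chosen with a nonvanishing partial derivative. -/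
lemma exists_relation_pderiv_ne_zero {K L σ : Type*} [Field K] [CharZero K] [Field L]
    [Algebra K L] (y : σ → L) (hy : ¬ AlgebraicIndependent K y) :
    ∃ P : MvPolynomial σ K, MvPolynomial.aeval y P = 0 ∧
      ∃ j, MvPolynomial.aeval y (MvPolynomial.pderiv j P) ≠ 0 := by
  classical
  have hex : ∃ n, ∃ P : MvPolynomial σ K, P ≠ 0 ∧ MvPolynomial.aeval y P = 0 ∧
      P.totalDegree = n := by
    rw [algebraicIndependent_iff] at hy
    push Not at hy
    obtain ⟨P, h1, h2⟩ := hy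
    exact ⟨_, P, h2, h1, rfl⟩
  -- A relation of least total degree: partial derivatives that vanish at `y` must vanish
  -- identically, and then `P` is a constant that is zero.
  obtain ⟨P, hP0, hP, hdeg⟩ := Nat.find_spec hex
  refine ⟨P, hP, ?_⟩
  by_contra! hc
  have hz : ∀ i, MvPolynomial.pderiv i P = 0 := by
    intro i
    by_contra hi
    exact Nat.find_min hex (hdeg ▸ totalDegree_pderiv_lt i P hi) ⟨_, hi, hc i, rfl⟩
  have hPC := eq_C_of_pderiv_eq_zero P hz
  rw [hPC, MvPolynomial.aeval_C] at hP
  have : MvPolynomial.coeff 0 P = 0 := by simpa using hP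
  exact hP0 (by rw [hPC, this, MvPolynomial.C_0])

/-- A derivation extends to the field of fractions. -/
lemma exists_derivation_extension {K A L : Type*} [Field K] [CommRing A] [IsDomain A]
    [Algebra K A] [Field L] [Algebra A L] [IsFractionRing A L] [Algebra K L] [IsScalarTower K A L]
    (δ : Derivation K A A) :
    ∃ δ' : Derivation K L L, ∀ a, δ' (algebraMap A L a) = algebraMap A L (δ a) := by
  -- A derivation is a ring homomorphism `a ↦ a + ε δ a` into the dual numbers. It extends to
  -- fractions because an element there is a unit as soon as its first component is.
  let f : A →+* TrivSqZeroExt L L :=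
    { toFun := fun a => TrivSqZeroExt.inl (algebraMap A L a)
        + TrivSqZeroExt.inr (algebraMap A L (δ a))
      map_one' := by simp
      map_zero' := by simp
      map_mul' := fun a b => by
        apply TrivSqZeroExt.ext
        · simp
        · simp only [Derivation.leibniz, smul_eq_mul, map_add, map_mul, TrivSqZeroExt.snd_add,
            TrivSqZeroExt.snd_inl, TrivSqZeroExt.snd_inr, zero_add, TrivSqZeroExt.snd_mul,
            TrivSqZeroExt.fst_add, TrivSqZeroExt.fst_inl, TrivSqZeroExt.fst_inr, add_zero,
            MulOpposite.smul_eq_mul_unop, MulOpposite.unop_op]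
          ring
      map_add' := fun a b => by
        apply TrivSqZeroExt.ext
        · simp
        · simp only [map_add, TrivSqZeroExt.snd_add, TrivSqZeroExt.snd_inl,
            TrivSqZeroExt.snd_inr, zero_add] }
  have hf1 : ∀ a, (f a).fst = algebraMap A L a := fun a => by simp [f]
  have hf2 : ∀ a, (f a).snd = algebraMap A L (δ a) := fun a => by
    change (TrivSqZeroExt.inl (algebraMap A L a) + TrivSqZeroExt.inr (algebraMap A L (δ a))).snd
      = _
    rw [TrivSqZeroExt.snd_add, TrivSqZeroExt.snd_inl, TrivSqZeroExt.snd_inr, zero_add]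
  clear_value f
  have hf : ∀ a : nonZeroDivisors A, IsUnit (f a) := by
    intro a
    rw [TrivSqZeroExt.isUnit_iff_isUnit_fst, hf1]
    exact IsLocalization.map_units L a
  obtain ⟨g, hg⟩ : ∃ g : L →+* TrivSqZeroExt L L, ∀ a, g (algebraMap A L a) = f a :=
    ⟨IsLocalization.lift hf, fun a => IsLocalization.lift_eq hf a⟩
  have hfst : ∀ x, (g x).fst = x := by
    have : (TrivSqZeroExt.fstHom L L L).toRingHom.comp g = RingHom.id L := by
      apply IsLocalization.ringHom_ext (nonZeroDivisors A)
      ext a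
      change (g (algebraMap A L a)).fst = algebraMap A L a
      rw [hg, hf1]
    exact fun x => congrArg (fun h : L →+* L => h x) this
  have hK : ∀ c : K, (g (algebraMap K L c)).snd = 0 := by
    intro c
    rw [IsScalarTower.algebraMap_apply K A L, hg, hf2, Derivation.map_algebraMap, map_zero]
  refine ⟨Derivation.mk'
    { toFun := fun x => (g x).snd
      map_add' := fun x y => by rw [map_add, TrivSqZeroExt.snd_add]
      map_smul' := fun c x => by
        rw [Algebra.smul_def, map_mul, TrivSqZeroExt.snd_mul, hK, hfst, smul_zero, add_zero,
          RingHom.id_apply, algebraMap_smul] } ?_, ?_⟩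
  · intro a b
    change (g (a * b)).snd = a • (g b).snd + b • (g a).snd
    rw [map_mul, TrivSqZeroExt.snd_mul, hfst, hfst, op_smul_eq_smul]
  · intro a
    change (g (algebraMap A L a)).snd = _
    rw [hg, hf2]

/-- A derivation vanishes on elements that are algebraic over a set it kills. -/
lemma derivation_eq_zero_of_isAlgebraic {K L : Type*} [Field K] [CharZero K] [Field L]
    [Algebra K L] (δ : Derivation K L L) (s : Set L) (hs : ∀ x ∈ s, δ x = 0) (z : L)
    (hz : IsAlgebraic (Algebra.adjoin K s) z) : δ z = 0 := by
  classical
  have hA : ∀ x ∈ Algebra.adjoin K s, δ x = 0 := by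
    intro x hx
    have := Derivation.eqOn_adjoin (D1 := δ) (D2 := 0) (s := s) (fun y hy => by simp [hs y hy]) hx
    simpa using this
  -- Killing the subalgebra makes `δ` linear over it, so the chain rule applies to a relation `p`
  -- for `z` of least degree, where `p'(z) ≠ 0`.
  let δ' : Derivation (Algebra.adjoin K s) L L := Derivation.mk'
    { toFun := δ
      map_add' := fun x y => map_add δ x y
      map_smul' := fun c x => by simp [Algebra.smul_def, hA c c.2] }
    (fun a b => by simp)
  have hex : ∃ n, ∃ p : Polynomial (Algebra.adjoin K s), p ≠ 0 ∧ Polynomial.aeval z p = 0 ∧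
      p.natDegree = n := by
    obtain ⟨p, h1, h2⟩ := hz
    exact ⟨_, p, h1, h2, rfl⟩
  obtain ⟨p, hp0, hp, hdeg⟩ := Nat.find_spec hex
  have hchar : CharZero (Algebra.adjoin K s) :=
    charZero_of_injective_algebraMap (FaithfulSMul.algebraMap_injective K _)
  have hdpos : p.natDegree ≠ 0 := by
    intro h0
    rw [Polynomial.eq_C_of_natDegree_eq_zero h0, Polynomial.aeval_C] at hp
    have : p.coeff 0 = 0 := by simpa using hp
    exact hp0 (by rw [Polynomial.eq_C_of_natDegree_eq_zero h0, this, Polynomial.C_0])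
  have hd : Polynomial.aeval z (Polynomial.derivative p) ≠ 0 := by
    intro h0
    have h1 : Polynomial.derivative p ≠ 0 := fun h =>
      hdpos (Polynomial.derivative_eq_zero.1 h)
    exact Nat.find_min hex (hdeg ▸ Polynomial.natDegree_derivative_lt hdpos) ⟨_, h1, h0, rfl⟩
  have h1 : δ' (Polynomial.aeval z p) = Polynomial.aeval z (Polynomial.derivative p) • δ' z :=
    Derivation.map_aeval δ' p z
  rw [hp, map_zero, smul_eq_mul] at h1
  exact (mul_eq_zero.1 h1.symm).resolve_left hd

/-- The Jacobian criterion: algebraically independent elements have linearly independent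
gradients. -/
lemma linearIndependent_gradient {K L ι κ : Type*} [Field K] [CharZero K] [Field L]
    [Algebra K L] [Fintype ι] [DecidableEq ι] (x : ι → L) (hx : IsTranscendenceBasis K x)
    (d : ι → Derivation K L L) (hd : ∀ i j, d i (x j) = if i = j then 1 else 0) (y : κ → L)
    (hy : AlgebraicIndependent K y) : LinearIndependent L (fun j i => d i (y j)) := by
  obtain ⟨s, hs, hbasis⟩ := exists_isTranscendenceBasis_superset (R := K) hy.coe_range
  have hcard := hx.lift_cardinalMk_eq hbasis
  have hfin : Finite s := by
    rw [← Cardinal.lt_aleph0_iff_finite, ← Cardinal.lift_lt_aleph0, ← hcard,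
      Cardinal.lift_lt_aleph0, Cardinal.lt_aleph0_iff_finite]
    infer_instance
  have := Fintype.ofFinite s
  have hcard' : Fintype.card s = Fintype.card ι := by
    simpa [Cardinal.mk_fintype] using hcard.symm
  have hspan : (⊤ : Submodule L (ι → L)) ≤
      Submodule.span L (Set.range fun z : s => fun i => d i (z : L)) := by
    by_contra hlt
    -- A form `l` that kills all gradients of the transcendence basis `s` gives the derivation `∑
    -- l(e_i) d_i`. It is zero on `s`, hence everywhere by algebraicity, and its values at the `x j`
    -- force `l = 0`.
    obtain ⟨l, hl0, hl⟩ := Submodule.exists_le_ker_of_lt_top _ (lt_top_iff_ne_top.2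
      (fun h => hlt h.ge))
    let δ : Derivation K L L := ∑ i, l (Pi.single i 1) • d i
    have hδ : ∀ z, δ z = l fun i => d i z := by
      intro z
      have h1 : (fun i => d i z) = ∑ i, d i z • (Pi.single i (1 : L) : ι → L) := by
        ext j
        simp [Finset.sum_apply, Pi.single_apply]
      rw [h1, map_sum]
      simp only [δ, map_smul, smul_eq_mul]
      rw [← Derivation.coeFnAddMonoidHom_apply, map_sum, Finset.sum_apply]
      simp [mul_comm]
    have hδ0 : ∀ z, δ z = 0 := by
      intro z
      have halg := hbasis.isAlgebraic
      rw [Subtype.range_coe] at halg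
      refine derivation_eq_zero_of_isAlgebraic δ s (fun w hw => ?_) z (halg.isAlgebraic z)
      rw [hδ]
      exact hl (Submodule.subset_span ⟨⟨w, hw⟩, rfl⟩)
    apply hl0
    apply LinearMap.pi_ext'
    intro j
    ext
    have h2 := hδ0 (x j)
    rw [hδ] at h2
    simp only [hd] at h2
    have h3 : (fun i => if i = j then (1 : L) else 0) = Pi.single j 1 := by
      ext i
      simp [Pi.single_apply]
    rw [h3] at h2
    simpa using h2
  have hli := linearIndependent_of_top_le_span_of_card_eq_finrank hspan (by simp [hcard'])
  exact hli.comp (fun j => ⟨y j, hs ⟨j, rfl⟩⟩) fun a b hab => hy.injective (by simpa using hab)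

/-- If the gradient of `y 2` is a combination of the independent gradients of `y 0` and `y 1`,
then `y 2` is a simple root of a polynomial relation over `y 0` and `y 1`. -/
lemma exists_relation_of_gradient_mem_span {K L ι : Type*} [Field K] [CharZero K] [Field L]
    [Algebra K L] [Fintype ι] [DecidableEq ι] (x : ι → L) (hx : IsTranscendenceBasis K x)
    (d : ι → Derivation K L L) (hd : ∀ i j, d i (x j) = if i = j then 1 else 0) (a b c : L)
    (hab : LinearIndependent L ![fun i => d i a, fun i => d i b])
    (hc : ¬ LinearIndependent L ![fun i => d i a, fun i => d i b, fun i => d i c]) :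
    ∃ P : MvPolynomial (Fin 3) K, MvPolynomial.aeval ![a, b, c] P = 0 ∧
      MvPolynomial.aeval ![a, b, c] (MvPolynomial.pderiv 2 P) ≠ 0 := by
  obtain ⟨P, hP, j, hj⟩ := exists_relation_pderiv_ne_zero (K := K) ![a, b, c] (fun h => hc (by
    have := linearIndependent_gradient x hx d hd _ h
    convert this using 1
    ext j i
    fin_cases j <;> rfl))
  refine ⟨P, hP, fun h2 => hj ?_⟩
  -- Were the last partial derivative zero, differentiating the relation would relate the two
  -- independent gradients, and all three partial derivatives would vanish.
  have h3 : ∀ i, MvPolynomial.aeval ![a, b, c] (MvPolynomial.pderiv 0 P) * d i a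
      + MvPolynomial.aeval ![a, b, c] (MvPolynomial.pderiv 1 P) * d i b = 0 := by
    intro i
    have := derivation_mvPolynomial_aeval (d i) ![a, b, c] P
    rw [hP, map_zero, Fin.sum_univ_three, h2] at this
    simpa using this.symm
  have h4 := LinearIndependent.pair_iff.1 hab _ _ (funext h3)
  fin_cases j
  · exact h4.1
  · exact h4.2
  · exact h2

end Formal

/-! ### Ziglin's descent over power series -/

section Descent

open PowerSeries

lemma exists_eq_X_pow_mul {L : Type*} [Field L] {f : PowerSeries L} (hf : f ≠ 0) :
    ∃ (n : ℕ) (s : PowerSeries L), f = X ^ n * s ∧ constantCoeff s ≠ 0 :=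
  ⟨f.order.toNat, divXPowOrder f, (X_pow_order_mul_divXPowOrder).symm, by
    simpa [constantCoeff_divXPowOrder_eq_zero_iff] using hf⟩

lemma X_pow_mul_inj {L : Type*} [Field L] {a b : ℕ} {s t : PowerSeries L}
    (hs : constantCoeff s ≠ 0) (ht : constantCoeff t ≠ 0) (h : X ^ a * s = X ^ b * t) :
    a = b := by
  have key : ∀ {n : ℕ} {s : PowerSeries L}, constantCoeff s ≠ 0 → (X ^ n * s).order = (n : ℕ∞) := by
    intro n s hs
    rw [order_mul, order_X_pow, order_zero_of_unit, add_zero]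
    exact isUnit_iff_constantCoeff.2 (isUnit_iff_ne_zero.2 hs)
  have := congrArg order h
  rw [key hs, key ht] at this
  exact_mod_cast this

/-- The quotient rule without division: `a` plays the role of `c / b` when this quotient happens to
be a power series. -/
lemma derivation_eq_zero_of_mul_eq {K R : Type*} [CommRing K] [CommRing R] [IsDomain R]
    [Algebra K R] (δ : Derivation K R R) {a b c : R} (h : a * b = c) (hb0 : b ≠ 0)
    (hb : δ b = 0) (hc : δ c = 0) : δ a = 0 := by
  have := congrArg δ h
  rw [Derivation.leibniz, hb, hc, smul_zero, zero_add, smul_eq_mul] at this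
  exact (mul_eq_zero.1 this).resolve_left hb0

/-- Dividing by powers of `H` changes the differentials by a triangular matrix; this lemma and the
next pass to the normalised integrals and back. -/
lemma linearIndependent_of_triangular {L W : Type*} [Field L] [AddCommGroup W] [Module L W]
    {a b c : W} {β γ β' γ' : L} (hβ : β ≠ 0) (hγ : γ ≠ 0)
    (h : LinearIndependent L ![a, b, c]) :
    LinearIndependent L ![a, β • b + β' • a, γ • c + γ' • a] := by
  rw [Fintype.linearIndependent_iff] at h ⊢
  intro g hg
  have h1 := h ![g 0 + g 1 * β' + g 2 * γ', g 1 * β, g 2 * γ] (by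
    rw [← hg, Fin.sum_univ_three, Fin.sum_univ_three]
    simp only [Matrix.cons_val]
    module)
  have e0 := h1 0
  have e1 := h1 1
  have e2 := h1 2
  simp only [Matrix.cons_val, mul_eq_zero, hβ, hγ, or_false] at e0 e1 e2
  rw [e1, e2] at e0
  intro i
  fin_cases i
  · simpa using e0
  · exact e1
  · exact e2

lemma linearIndependent_of_triangular_four {L W : Type*} [Field L] [AddCommGroup W] [Module L W]
    {a b c e : W} {β γ β' γ' : L} (hβ : β ≠ 0) (hγ : γ ≠ 0)
    (h : LinearIndependent L ![a, β • b + β' • a, γ • c + γ' • a, e]) :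
    LinearIndependent L ![a, b, c, e] := by
  rw [Fintype.linearIndependent_iff] at h ⊢
  intro g hg
  have h1 := h ![g 0 - g 1 * β⁻¹ * β' - g 2 * γ⁻¹ * γ', g 1 * β⁻¹, g 2 * γ⁻¹, g 3] (by
    rw [← hg, Fin.sum_univ_four, Fin.sum_univ_four]
    simp only [Matrix.cons_val]
    have hb : (g 1 * β⁻¹) • β • b = g 1 • b := by
      rw [smul_smul, mul_assoc, inv_mul_cancel₀ hβ, mul_one]
    have hc : (g 2 * γ⁻¹) • γ • c = g 2 • c := by
      rw [smul_smul, mul_assoc, inv_mul_cancel₀ hγ, mul_one]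
    rw [smul_add, smul_add, hb, hc]
    module)
  have e0 := h1 0
  have e1 := h1 1
  have e2 := h1 2
  have e3 := h1 3
  simp only [Matrix.cons_val, mul_eq_zero, _root_.inv_eq_zero, hβ, hγ, or_false] at e0 e1 e2 e3
  rw [e1, e2] at e0
  intro i
  fin_cases i
  · simpa using e0
  · exact e1
  · exact e2
  · exact e3

/-- Ziglin's descent: a first integral independent of `H`, `r₁`, `r₂` can be changed into one whose
leading coefficient is independent of the leading coefficients of `H`, `r₁`, `r₂`. -/
theorem exists_independent_leading_coeff {K L ι : Type*} [Field K] [CharZero K] [Field L]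
    [Algebra K L] [Fintype ι] [DecidableEq ι] (x : ι → L) (hx : IsTranscendenceBasis K x)
    (d : ι → Derivation K L L) (hd : ∀ i j, d i (x j) = if i = j then 1 else 0)
    (e : ι → L) (T V D : Derivation K (PowerSeries L) (PowerSeries L))
    (hTE : ∀ z, T z = 0 → ∑ i, e i * d i (constantCoeff z) = 0)
    (H H' r₁ r₂ : PowerSeries L) (hH : H = X ^ 2 * H') (hH0 : constantCoeff H' ≠ 0)
    (hE : ∑ i, e i * d i (constantCoeff H') = 2 * constantCoeff H')
    (hTH : T H = 0) (hVH : V H = 0) (hDH : D H = 0)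
    (hT₁ : T r₁ = 0) (hV₁ : V r₁ = 0) (hD₁ : D r₁ = 0)
    (hT₂ : T r₂ = 0) (hV₂ : V r₂ = 0) (hD₂ : D r₂ = 0)
    (hind : LinearIndependent L ![fun i => d i (constantCoeff H'),
      fun i => d i (constantCoeff r₁), fun i => d i (constantCoeff r₂)])
    (z : PowerSeries L) (hTz : T z = 0) (hVz : V z = 0) (hDz : D z ≠ 0) :
    ∃ z : PowerSeries L, T z = 0 ∧ V z = 0 ∧
      LinearIndependent L ![fun i => d i (constantCoeff H'),
        fun i => d i (constantCoeff r₁), fun i => d i (constantCoeff r₂),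
        fun i => d i (constantCoeff z)] := by
  have hchar : CharZero L := charZero_of_injective_algebraMap (algebraMap K L).injective
  obtain ⟨n, s, hs, hs0⟩ := exists_eq_X_pow_mul hDz
  clear hDz
  induction n using Nat.strong_induction_on generalizing z s with
  | _ n ih =>
  by_cases hz : LinearIndependent L ![fun i => d i (constantCoeff H'),
        fun i => d i (constantCoeff r₁), fun i => d i (constantCoeff r₂),
        fun i => d i (constantCoeff z)]
  · exact ⟨z, hTz, hVz, hz⟩
  have hind12 : LinearIndependent L
      ![fun i => d i (constantCoeff r₁), fun i => d i (constantCoeff r₂)] := by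
    have := hind.comp (Fin.succ : Fin 2 → Fin 3) (Fin.succ_injective _)
    convert this using 1
    ext j i
    fin_cases j <;> rfl
  -- Contract a linear relation with the Euler field `e`. The terms of `r₁`, `r₂`, `z` vanish,
  -- having weight zero, and that of `H'` gives `2 H'(0) ≠ 0`; so `H'` does not occur in the
  -- relation.
  have hdep : ¬ LinearIndependent L ![fun i => d i (constantCoeff r₁),
      fun i => d i (constantCoeff r₂), fun i => d i (constantCoeff z)] := by
    intro h3
    apply hz
    rw [Fintype.linearIndependent_iff] at h3 ⊢
    intro g hg
    rw [Fin.sum_univ_four] at hg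
    simp only [Matrix.cons_val] at hg
    have hg' : ∀ i, g 0 * d i (constantCoeff H') + g 1 * d i (constantCoeff r₁)
        + g 2 * d i (constantCoeff r₂) + g 3 * d i (constantCoeff z) = 0 := fun i =>
      congrFun hg i
    have hsum : ∑ i, e i * (g 0 * d i (constantCoeff H') + g 1 * d i (constantCoeff r₁)
        + g 2 * d i (constantCoeff r₂) + g 3 * d i (constantCoeff z)) = 0 :=
      Finset.sum_eq_zero fun i _ => by rw [hg' i, mul_zero]
    have hsum' : g 0 * ∑ i, e i * d i (constantCoeff H')
        + g 1 * ∑ i, e i * d i (constantCoeff r₁) + g 2 * ∑ i, e i * d i (constantCoeff r₂)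
        + g 3 * ∑ i, e i * d i (constantCoeff z) = 0 := by
      rw [← hsum]
      simp only [Finset.mul_sum, ← Finset.sum_add_distrib]
      exact Finset.sum_congr rfl fun i _ => by ring
    rw [hTE _ hT₁, hTE _ hT₂, hTE _ hTz, hE] at hsum'
    have hg0 : g 0 = 0 := by
      have h5 : g 0 * (2 * constantCoeff H') = 0 := by simpa using hsum'
      exact (mul_eq_zero.1 h5).resolve_right (mul_ne_zero two_ne_zero hH0)
    have h6 := h3 ![g 1, g 2, g 3] (by
      rw [Fin.sum_univ_three]
      ext i
      simpa [hg0] using hg' i)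
    intro i
    fin_cases i
    · exact hg0
    · exact h6 0
    · exact h6 1
    · exact h6 2
  obtain ⟨P, hP, hP2⟩ := exists_relation_of_gradient_mem_span x hx d hd _ _ _ hind12 hdep
  have hcc : ∀ Q : MvPolynomial (Fin 3) K,
      constantCoeff (MvPolynomial.aeval ![r₁, r₂, z] Q)
        = MvPolynomial.aeval ![constantCoeff r₁, constantCoeff r₂, constantCoeff z] Q := by
    intro Q
    induction Q using MvPolynomial.induction_on with
    | C a => simp [PowerSeries.algebraMap_apply]
    | add p q hp hq => simp [hp, hq]
    | mul_X p i hp =>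
      rw [map_mul, map_mul, map_mul, hp]
      fin_cases i <;> simp
  set u := MvPolynomial.aeval ![r₁, r₂, z] P with hu
  have hderiv : ∀ δ : Derivation K (PowerSeries L) (PowerSeries L), δ r₁ = 0 → δ r₂ = 0 →
      δ u = MvPolynomial.aeval ![r₁, r₂, z] (MvPolynomial.pderiv 2 P) * δ z := by
    intro δ h1 h2
    rw [hu, derivation_mvPolynomial_aeval, Fin.sum_univ_three]
    simp [h1, h2]
  have hTu : T u = 0 := by rw [hderiv T hT₁ hT₂, hTz, mul_zero]
  have hVu : V u = 0 := by rw [hderiv V hV₁ hV₂, hVz, mul_zero]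
  have hDu := hderiv D hD₁ hD₂
  set t := MvPolynomial.aeval ![r₁, r₂, z] (MvPolynomial.pderiv 2 P) with ht
  have ht0 : constantCoeff t ≠ 0 := by rwa [ht, hcc]
  have hu0 : constantCoeff u = 0 := by rw [hu, hcc, hP]
  have hune : u ≠ 0 := by
    intro h
    rw [h, map_zero, hs] at hDu
    have hs' : s ≠ 0 := fun h => hs0 (by simp [h])
    have ht' : t ≠ 0 := fun h => ht0 (by simp [h])
    exact mul_ne_zero ht' (mul_ne_zero (pow_ne_zero _ X_ne_zero) hs') hDu.symm
  obtain ⟨k, v, huv, hv0⟩ := exists_eq_X_pow_mul hune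
  have hk : k ≠ 0 := by
    rintro rfl
    rw [huv] at hu0
    simp [hv0] at hu0
  have hHinv : H'⁻¹ * H' = 1 := PowerSeries.inv_mul_cancel _ hH0
  -- The new integral is `u² / H^k`. Squaring makes both orders equal to `2 k`, since `H` has order
  -- two and `k` may be odd.
  have hz' : (v ^ 2 * H'⁻¹ ^ k) * H ^ k = u ^ 2 := by
    rw [huv, hH]
    calc v ^ 2 * H'⁻¹ ^ k * (X ^ 2 * H') ^ k = v ^ 2 * (X ^ k) ^ 2 * (H'⁻¹ * H') ^ k := by ring
      _ = _ := by rw [hHinv]; ring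
  have hHne : H ^ k ≠ 0 := by
    have : H' ≠ 0 := fun h => hH0 (by simp [h])
    rw [hH]
    exact pow_ne_zero _ (mul_ne_zero (pow_ne_zero _ X_ne_zero) this)
  have hpow : ∀ δ : Derivation K (PowerSeries L) (PowerSeries L), δ H = 0 → δ (H ^ k) = 0 :=
    fun δ h => by simp [Derivation.leibniz_pow, h]
  have hsq : ∀ δ : Derivation K (PowerSeries L) (PowerSeries L), δ (u ^ 2) = 2 * u * δ u :=
    fun δ => by simp [Derivation.leibniz_pow, mul_assoc]
  have hT' := derivation_eq_zero_of_mul_eq T hz' hHne (hpow T hTH) (by rw [hsq, hTu, mul_zero])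
  have hV' := derivation_eq_zero_of_mul_eq V hz' hHne (hpow V hVH) (by rw [hsq, hVu, mul_zero])
  have hD' := congrArg D hz'
  rw [Derivation.leibniz, hpow D hDH, smul_zero, zero_add, smul_eq_mul, hsq, hDu, hs] at hD'
  have h2v : constantCoeff (2 * v * t * s) ≠ 0 := by
    rw [map_mul, map_mul, map_mul]
    have : constantCoeff (2 : PowerSeries L) = 2 := map_ofNat _ 2
    rw [this]
    exact mul_ne_zero (mul_ne_zero (mul_ne_zero two_ne_zero hv0) ht0) hs0
  -- From `H^k · D(u² / H^k) = 2 u t · D z`: the left factor has order `2 k`, and `u` only `k`, so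
  -- the order of `D` of the integral drops from `n` to `n - k`.
  have hD'' : X ^ k * (D (v ^ 2 * H'⁻¹ ^ k) * H' ^ k) = X ^ n * (2 * v * t * s) := by
    apply mul_left_cancel₀ (pow_ne_zero k (X_ne_zero (R := L)))
    rw [hH] at hD'
    rw [huv] at hD'
    linear_combination hD'
  have hDne : D (v ^ 2 * H'⁻¹ ^ k) ≠ 0 := by
    intro h
    rw [h, zero_mul, mul_zero] at hD''
    have : (2 * v * t * s) ≠ 0 := fun h => h2v (by simp [h])
    exact mul_ne_zero (pow_ne_zero _ X_ne_zero) this hD''.symm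
  obtain ⟨m, s', hs', hs0'⟩ := exists_eq_X_pow_mul hDne
  refine ih m ?_ _ hT' hV' s' hs' hs0'
  have hkm : k + m = n := by
    refine X_pow_mul_inj (s := s' * H' ^ k) ?_ h2v ?_
    · rw [map_mul, map_pow]
      exact mul_ne_zero hs0' (pow_ne_zero _ hH0)
    · rw [← hD'', hs']
      ring
  omega

/-- Formal version of Ziglin's lemma for the quotient `P / Q` of two power series and for `H`,
`G₁`, `G₂` of the orders `2`, `4`, `3`. -/
theorem exists_independent_leading_coeff_of_quotient {K L ι : Type*} [Field K] [CharZero K]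
    [Field L] [Algebra K L] [Fintype ι] [DecidableEq ι] (x : ι → L)
    (hx : IsTranscendenceBasis K x) (d : ι → Derivation K L L)
    (hd : ∀ i j, d i (x j) = if i = j then 1 else 0)
    (e : ι → L) (T V D : Derivation K (PowerSeries L) (PowerSeries L))
    (hTE : ∀ z, T z = 0 → ∑ i, e i * d i (constantCoeff z) = 0)
    (H H' G₁ G₁' G₂ G₂' : PowerSeries L) (hH : H = X ^ 2 * H') (hG₁ : G₁ = X ^ 4 * G₁')
    (hG₂ : G₂ = X ^ 3 * G₂')
    (hE : ∑ i, e i * d i (constantCoeff H') = 2 * constantCoeff H')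
    (hTH : T H = 0) (hVH : V H = 0) (hDH : D H = 0)
    (hT₁ : T G₁ = 0) (hV₁ : V G₁ = 0) (hD₁ : D G₁ = 0)
    (hT₂ : T G₂ = 0) (hV₂ : V G₂ = 0) (hD₂ : D G₂ = 0)
    (hind : LinearIndependent L ![fun i => d i (constantCoeff H'),
      fun i => d i (constantCoeff G₁'), fun i => d i (constantCoeff G₂')])
    (P Q : PowerSeries L) (hQ : Q ≠ 0) (hTP : T P = 0) (hTQ : T Q = 0)
    (hV : Q * V P - P * V Q = 0) (hD : Q * D P - P * D Q ≠ 0) :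
    ∃ z : PowerSeries L, V z = 0 ∧
      LinearIndependent L ![fun i => d i (constantCoeff H'),
        fun i => d i (constantCoeff G₁'), fun i => d i (constantCoeff G₂'),
        fun i => d i (constantCoeff z)] := by
  have hchar : CharZero L := charZero_of_injective_algebraMap (algebraMap K L).injective
  have hh0 : constantCoeff H' ≠ 0 := by
    intro h
    apply hind.ne_zero 0
    ext i
    simp [h]
  have hg0 : constantCoeff G₂' ≠ 0 := by
    intro h
    apply hind.ne_zero 2
    ext i
    simp [h]
  have hHinv : H'⁻¹ * H' = 1 := PowerSeries.inv_mul_cancel _ hh0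
  have hHne : H ≠ 0 := by
    have : H' ≠ 0 := fun h => hh0 (by simp [h])
    rw [hH]
    exact mul_ne_zero (pow_ne_zero _ X_ne_zero) this
  have hpow : ∀ δ : Derivation K (PowerSeries L) (PowerSeries L), ∀ a : PowerSeries L, ∀ k,
      δ a = 0 → δ (a ^ k) = 0 :=
    fun δ a k h => by simp [Derivation.leibniz_pow, h]
  -- The exponents match the orders `4 = 2 · 2` and `2 · 3 = 3 · 2`, so `G₁ / H²` and `G₂² / H³` are
  -- power series of weight zero.
  have hr₁ : (G₁' * H'⁻¹ ^ 2) * H ^ 2 = G₁ := by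
    rw [hH, hG₁]
    calc G₁' * H'⁻¹ ^ 2 * (X ^ 2 * H') ^ 2 = X ^ 4 * G₁' * (H'⁻¹ * H') ^ 2 := by ring
      _ = _ := by rw [hHinv]; ring
  have hr₂ : (G₂' ^ 2 * H'⁻¹ ^ 3) * H ^ 3 = G₂ ^ 2 := by
    rw [hH, hG₂]
    calc G₂' ^ 2 * H'⁻¹ ^ 3 * (X ^ 2 * H') ^ 3 = (X ^ 3 * G₂') ^ 2 * (H'⁻¹ * H') ^ 3 := by ring
      _ = _ := by rw [hHinv]; ring
  have hk₁ : ∀ δ : Derivation K (PowerSeries L) (PowerSeries L), δ H = 0 → δ G₁ = 0 →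
      δ (G₁' * H'⁻¹ ^ 2) = 0 := fun δ h1 h2 =>
    derivation_eq_zero_of_mul_eq δ hr₁ (pow_ne_zero _ hHne) (hpow δ _ _ h1) h2
  have hk₂ : ∀ δ : Derivation K (PowerSeries L) (PowerSeries L), δ H = 0 → δ G₂ = 0 →
      δ (G₂' ^ 2 * H'⁻¹ ^ 3) = 0 := fun δ h1 h2 =>
    derivation_eq_zero_of_mul_eq δ hr₂ (pow_ne_zero _ hHne) (hpow δ _ _ h1) (hpow δ _ _ h2)
  obtain ⟨b, Q', hQ', hQ0⟩ := exists_eq_X_pow_mul hQ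
  have hQinv : Q'⁻¹ * Q' = 1 := PowerSeries.inv_mul_cancel _ hQ0
  -- This is `P² H^b / Q²`; both `H^b` and `Q²` have order `2 b`.
  set z := P ^ 2 * H'  ^ b * Q'⁻¹ ^ 2 with hzdef
  have hz : z * Q ^ 2 = P ^ 2 * H ^ b := by
    rw [hzdef, hH, hQ']
    calc P ^ 2 * H' ^ b * Q'⁻¹ ^ 2 * (X ^ b * Q') ^ 2
        = P ^ 2 * (X ^ 2 * H') ^ b * (Q'⁻¹ * Q') ^ 2 := by ring
      _ = _ := by rw [hQinv]; ring
  have hTz : T z = 0 := derivation_eq_zero_of_mul_eq T hz (pow_ne_zero _ hQ) (hpow T _ _ hTQ)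
    (by rw [Derivation.leibniz, hpow T _ _ hTH, hpow T _ _ hTP, smul_zero, smul_zero, add_zero])
  have hquot : ∀ δ : Derivation K (PowerSeries L) (PowerSeries L), δ H = 0 →
      δ z * Q ^ 3 = 2 * P * H ^ b * (Q * δ P - P * δ Q) := by
    intro δ hδ
    have h := congrArg δ hz
    simp only [Derivation.leibniz, Derivation.leibniz_pow, hδ,
      smul_eq_mul, nsmul_eq_mul, Nat.cast_ofNat, Nat.add_one_sub_one, pow_one] at h
    linear_combination Q * h - 2 * δ Q * hz
  have hVz : V z = 0 := by
    have h := hquot V hVH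
    rw [hV, mul_zero] at h
    exact (mul_eq_zero.1 h).resolve_right (pow_ne_zero _ hQ)
  have hP : P ≠ 0 := fun h => hD (by simp [h])
  have hDz : D z ≠ 0 := by
    intro h0
    have h := hquot D hDH
    rw [h0, zero_mul] at h
    have h2 : (2 : PowerSeries L) ≠ 0 := by
      intro h3
      have := congrArg constantCoeff h3
      rw [map_zero, map_ofNat] at this
      exact two_ne_zero this
    exact mul_ne_zero (mul_ne_zero (mul_ne_zero h2 hP) (pow_ne_zero _ hHne)) hD h.symm
  have hd₁ : (fun i => d i (constantCoeff (G₁' * H'⁻¹ ^ 2)))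
      = ((constantCoeff H')⁻¹ ^ 2) • (fun i => d i (constantCoeff G₁'))
        + (-2 * constantCoeff G₁' * (constantCoeff H')⁻¹ ^ 3) •
          (fun i => d i (constantCoeff H')) := by
    ext i
    simp only [map_mul, map_pow, PowerSeries.constantCoeff_inv, Derivation.leibniz,
      Derivation.leibniz_pow, Derivation.leibniz_inv, smul_eq_mul, nsmul_eq_mul, Pi.add_apply,
      Pi.smul_apply]
    push_cast
    ring
  have hd₂ : (fun i => d i (constantCoeff (G₂' ^ 2 * H'⁻¹ ^ 3)))
      = (2 * constantCoeff G₂' * (constantCoeff H')⁻¹ ^ 3) • (fun i => d i (constantCoeff G₂'))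
        + (-3 * constantCoeff G₂' ^ 2 * (constantCoeff H')⁻¹ ^ 4) •
          (fun i => d i (constantCoeff H')) := by
    ext i
    simp only [map_mul, map_pow, PowerSeries.constantCoeff_inv, Derivation.leibniz,
      Derivation.leibniz_pow, Derivation.leibniz_inv, smul_eq_mul, nsmul_eq_mul, Pi.add_apply,
      Pi.smul_apply]
    push_cast
    ring
  have hβ : (constantCoeff H')⁻¹ ^ 2 ≠ 0 := pow_ne_zero _ (inv_ne_zero hh0)
  have hγ : 2 * constantCoeff G₂' * (constantCoeff H')⁻¹ ^ 3 ≠ 0 :=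
    mul_ne_zero (mul_ne_zero two_ne_zero hg0) (pow_ne_zero _ (inv_ne_zero hh0))
  obtain ⟨y, -, hVy, hy⟩ := exists_independent_leading_coeff x hx d hd e T V D hTE H H' _ _ hH hh0
    hE hTH hVH hDH (hk₁ T hTH hT₁) (hk₁ V hVH hV₁) (hk₁ D hDH hD₁) (hk₂ T hTH hT₂)
    (hk₂ V hVH hV₂) (hk₂ D hDH hD₂)
    (by rw [hd₁, hd₂]; exact linearIndependent_of_triangular hβ hγ hind) z hTz hVz hDz
  rw [hd₁, hd₂] at hy
  exact ⟨y, hVy, linearIndependent_of_triangular_four hβ hγ hy⟩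

end Descent

/-! ### Polynomials, dilations and Taylor polynomials on the phase space -/

section Expansion

open Asymptotics Filter

/-- Indices of the six coordinates of the phase space. -/
abbrev Idx : Type := Fin 3 ⊕ Fin 3

/-- The weights of the coordinates: `1` for `M` and `2` for `Γ`. -/
def wt : Idx → ℕ := Sum.elim (fun _ => 1) (fun _ => 2)

/-- The generic polynomial `X_i` placed in weight `wt i`, extended to all polynomials. -/
def scalePoly {K : Type*} [CommRing K] :
    MvPolynomial Idx K →ₐ[K] Polynomial (MvPolynomial Idx K) :=
  MvPolynomial.aeval fun i => Polynomial.C (MvPolynomial.X i) * Polynomial.X ^ wt i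

variable {𝕜 : Type*} [RCLike 𝕜]

/-- The coordinates of a point of the phase space. -/
def coords {R : Type*} (X : Phase R) : Idx → R := Sum.elim X.1 X.2

variable (𝕜) in
/-- The standard basis of the phase space. -/
def basisVec : Idx → Phase 𝕜 :=
  Sum.elim (fun i => (Pi.single i 1, 0)) (fun i => (0, Pi.single i 1))

variable (𝕜) in
/-- The coordinates as continuous linear functionals. -/
def coordCLM : Idx → Phase 𝕜 →L[𝕜] 𝕜 :=
  Sum.elim (fun i => (ContinuousLinearMap.proj i).comp (ContinuousLinearMap.fst 𝕜 _ _))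
    (fun i => (ContinuousLinearMap.proj i).comp (ContinuousLinearMap.snd 𝕜 _ _))

/-- The function on the phase space given by a polynomial. -/
def polyFun (q : MvPolynomial Idx 𝕜) (X : Phase 𝕜) : 𝕜 := MvPolynomial.eval (coords X) q

/-- The partial derivative along a coordinate. -/
def partialDeriv (i : Idx) (f : Phase 𝕜 → 𝕜) (X : Phase 𝕜) : 𝕜 := fderiv 𝕜 f X (basisVec 𝕜 i)

/-- The quasi-homogeneous dilation `(M, Γ) ↦ (ε M, ε² Γ)`. -/
def dilate (ε : 𝕜) (X : Phase 𝕜) : Phase 𝕜 := (ε • X.1, ε ^ 2 • X.2)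

lemma coordCLM_apply (i : Idx) (X : Phase 𝕜) : coordCLM 𝕜 i X = coords X i := by
  cases i <;> rfl

lemma coordCLM_basisVec (i j : Idx) : coordCLM 𝕜 i (basisVec 𝕜 j) = if j = i then 1 else 0 := by
  rw [coordCLM_apply]
  rcases i with i | i <;> rcases j with j | j <;>
    simp [coords, basisVec, Pi.single_apply, eq_comm]

lemma sum_coords_smul_basisVec (X : Phase 𝕜) : ∑ i, coords X i • basisVec 𝕜 i = X := by
  ext i
  · simp [coords, basisVec, Fintype.sum_sum_type, Prod.fst_sum, Finset.sum_apply, Pi.single_apply]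
  · simp [coords, basisVec, Fintype.sum_sum_type, Prod.snd_sum, Finset.sum_apply, Pi.single_apply]

lemma coords_dilate (ε : 𝕜) (X : Phase 𝕜) (i : Idx) :
    coords (dilate ε X) i = ε ^ wt i * coords X i := by
  rcases i with i | i <;> simp [coords, dilate, wt]

/-- Thus `scalePoly` sorts a polynomial by weight: its coefficient at `ε ^ n` is the weighted
homogeneous part of degree `n`. -/
lemma polyFun_dilate (q : MvPolynomial Idx 𝕜) (ε : 𝕜) (X : Phase 𝕜) :
    polyFun q (dilate ε X)
      = ((scalePoly q).map (MvPolynomial.eval (coords X))).eval ε := by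
  unfold polyFun
  induction q using MvPolynomial.induction_on with
  | C a => simp [scalePoly, Polynomial.algebraMap_apply, MvPolynomial.algebraMap_eq]
  | add p q hp hq => simp [hp, hq]
  | mul_X p i hp =>
    rw [map_mul, map_mul, Polynomial.map_mul, Polynomial.eval_mul, ← hp, MvPolynomial.eval_X,
      coords_dilate, mul_comm (ε ^ wt i)]
    simp [scalePoly]

lemma exists_hasFDerivAt_polyFun (q : MvPolynomial Idx 𝕜) (X : Phase 𝕜) :
    ∃ f' : Phase 𝕜 →L[𝕜] 𝕜, HasFDerivAt (polyFun q) f' X ∧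
      ∀ i, f' (basisVec 𝕜 i) = polyFun (MvPolynomial.pderiv i q) X := by
  classical
  unfold polyFun
  induction q using MvPolynomial.induction_on with
  | C a =>
    refine ⟨0, ?_, fun i => by simp⟩
    simpa using hasFDerivAt_const (𝕜 := 𝕜) a X
  | add p q hp hq =>
    obtain ⟨p', hp, hp'⟩ := hp
    obtain ⟨q', hq, hq'⟩ := hq
    refine ⟨p' + q', ?_, fun i => ?_⟩
    · simp only [map_add]
      exact hp.add hq
    · rw [map_add, map_add, ← hp', ← hq']
      rfl
  | mul_X p j hp =>
    obtain ⟨p', hp, hp'⟩ := hp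
    have h1 : HasFDerivAt (fun X : Phase 𝕜 => coords X j) (coordCLM 𝕜 j) X := by
      have := (coordCLM 𝕜 j).hasFDerivAt (x := X)
      have h2 : (fun X : Phase 𝕜 => coords X j) = coordCLM 𝕜 j :=
        funext fun X => (coordCLM_apply j X).symm
      rwa [h2]
    refine ⟨MvPolynomial.eval (coords X) p • coordCLM 𝕜 j + coords X j • p', ?_, fun i => ?_⟩
    · simp only [map_mul, MvPolynomial.eval_X]
      exact hp.mul h1
    · have h3 : (MvPolynomial.eval (coords X)) (Pi.single (M := fun _ => MvPolynomial Idx 𝕜) i 1 j)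
          = if i = j then 1 else 0 := by
        simp only [Pi.single_apply, eq_comm (a := j)]
        split_ifs
        · exact map_one _
        · exact map_zero _
      change MvPolynomial.eval (coords X) p * coordCLM 𝕜 j (basisVec 𝕜 i)
        + coords X j * p' (basisVec 𝕜 i) = _
      rw [Derivation.leibniz, MvPolynomial.pderiv_X, map_add, smul_eq_mul, smul_eq_mul, map_mul,
        map_mul, h3, hp', coordCLM_basisVec, MvPolynomial.eval_X]

lemma differentiableAt_polyFun (q : MvPolynomial Idx 𝕜) (X : Phase 𝕜) :
    DifferentiableAt 𝕜 (polyFun q) X :=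
  (exists_hasFDerivAt_polyFun q X).choose_spec.1.differentiableAt

lemma partialDeriv_polyFun (q : MvPolynomial Idx 𝕜) (i : Idx) :
    partialDeriv i (polyFun q) = polyFun (MvPolynomial.pderiv i q) := by
  ext X
  obtain ⟨f', hf, hf'⟩ := exists_hasFDerivAt_polyFun q X
  rw [partialDeriv, hf.fderiv, hf']

lemma analyticAt_polyFun (q : MvPolynomial Idx 𝕜) (X : Phase 𝕜) : AnalyticAt 𝕜 (polyFun q) X := by
  have h : ∀ i, AnalyticAt 𝕜 (fun X : Phase 𝕜 => coords X i) X := fun i => by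
    simpa only [← coordCLM_apply] using (coordCLM 𝕜 i).analyticAt X
  exact AnalyticAt.aeval_mvPolynomial h q

lemma analyticAt_partialDeriv {f : Phase 𝕜 → 𝕜} {X : Phase 𝕜} (hf : AnalyticAt 𝕜 f X) (i : Idx) :
    AnalyticAt 𝕜 (partialDeriv i f) X :=
  ((ContinuousLinearMap.apply 𝕜 𝕜 (basisVec 𝕜 i)).analyticAt _).comp hf.fderiv

/-- A polynomial describing the `n`-th term of a formal multilinear series. -/
lemma exists_polyFun_eq_diag (n : ℕ) (p : ContinuousMultilinearMap 𝕜 (fun _ : Fin n => Phase 𝕜) 𝕜) :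
    ∃ q : MvPolynomial Idx 𝕜, ∀ X, polyFun q X = p fun _ => X := by
  refine ⟨∑ v : Fin n → Idx, MvPolynomial.C (p fun j => basisVec 𝕜 (v j))
    * ∏ j, MvPolynomial.X (v j), fun X => ?_⟩
  conv_rhs => rw [← sum_coords_smul_basisVec X, p.map_sum]
  simp only [polyFun, map_sum, map_mul, MvPolynomial.eval_C, map_prod, MvPolynomial.eval_X]
  refine Finset.sum_congr rfl fun v _ => ?_
  rw [p.map_smul_univ, smul_eq_mul, mul_comm]

/-- Taylor polynomials of an analytic function and of its partial derivatives. -/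
lemma exists_taylor_polynomial {f : Phase 𝕜 → 𝕜} (hf : AnalyticAt 𝕜 f 0) (N : ℕ) :
    ∃ q : MvPolynomial Idx 𝕜,
      ((fun X => f X - polyFun q X) =O[𝓝 0] fun X => ‖X‖ ^ (N + 1)) ∧
      ∀ i, (fun X => partialDeriv i f X - polyFun (MvPolynomial.pderiv i q) X)
        =O[𝓝 0] fun X => ‖X‖ ^ N := by
  classical
  obtain ⟨p, r, hp⟩ := hf
  choose t ht using fun n => exists_polyFun_eq_diag n (p n)
  let q := ∑ n ∈ Finset.range (N + 1), t n
  have hq : ∀ X, polyFun q X = ∑ n ∈ Finset.range (N + 1), p n fun _ => X := fun X => by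
    simp only [← ht, q, polyFun, map_sum]
  -- The series without its first `N + 1` terms represents the remainder `f - q` on the same ball.
  -- Its derived series then bounds the partial derivatives, with one order lost.
  let p' : FormalMultilinearSeries 𝕜 (Phase 𝕜) 𝕜 := fun n => if n < N + 1 then 0 else p n
  have hlt : ∀ n, n < N + 1 → p' n = 0 := fun n h => if_pos h
  have hge : ∀ n, ¬ n < N + 1 → p' n = p n := fun n h => if_neg h
  have hnorm : ∀ n, ‖p' n‖ ≤ ‖p n‖ := fun n => by
    by_cases h : n < N + 1
    · simp [hlt n h]
    · rw [hge n h]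
  have hp' : HasFPowerSeriesOnBall (fun X => f X - polyFun q X) p' 0 r := by
    refine ⟨hp.r_le.trans ?_, hp.r_pos, fun {y} hy => ?_⟩
    · refine ENNReal.le_of_forall_nnreal_lt fun ρ hρ => ?_
      obtain ⟨C, -, hC⟩ := p.norm_mul_pow_le_of_lt_radius hρ
      exact p'.le_radius_of_bound C fun n =>
        (mul_le_mul_of_nonneg_right (hnorm n) (by positivity)).trans (hC n)
    · have h1 := hp.hasSum hy
      have h2 : HasSum (fun n => if n < N + 1 then p n fun _ => y else 0)
          (∑ n ∈ Finset.range (N + 1), p n fun _ => y) := by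
        have := hasSum_sum_of_ne_finset_zero (L := SummationFilter.unconditional ℕ)
          (f := fun n => if n < N + 1 then p n fun _ => y else 0)
          (s := Finset.range (N + 1)) (fun n hn => by
            rw [Finset.mem_range] at hn
            simp [hn])
        convert this using 1
        exact Finset.sum_congr rfl fun n hn => by rw [if_pos (Finset.mem_range.1 hn)]
      simp only [zero_add] at h1 ⊢
      rw [hq]
      convert h1.sub h2 using 1
      ext n
      by_cases h : n < N + 1
      · rw [hlt n h, if_pos h, sub_self]
        rfl
      · rw [hge n h, if_neg h, sub_zero]
  have hd := hp'.fderiv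
  refine ⟨q, ?_, fun i => ?_⟩
  · have h := hp'.hasFPowerSeriesAt.isBigO_sub_partialSum_pow (N + 1)
    have h0 : ∀ y, p'.partialSum (N + 1) y = 0 := fun y =>
      Finset.sum_eq_zero fun n hn => by rw [hlt n (Finset.mem_range.1 hn)]; rfl
    simpa [h0] using h
  · have h := hd.hasFPowerSeriesAt.isBigO_sub_partialSum_pow N
    have h0 : ∀ y, p'.derivSeries.partialSum N y = 0 := fun y =>
      Finset.sum_eq_zero fun n hn => by
        have : p' (n + 1) = 0 := hlt _ (by simpa using hn)
        rw [FormalMultilinearSeries.derivSeries_eq_zero _ this]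
        simp
    simp only [h0, zero_add, sub_zero] at h
    have hev : (fun X => partialDeriv i f X - polyFun (MvPolynomial.pderiv i q) X)
        =ᶠ[𝓝 0] fun X => fderiv 𝕜 (fun X => f X - polyFun q X) X (basisVec 𝕜 i) := by
      filter_upwards [hp.analyticAt.eventually_analyticAt] with X hX
      rw [← partialDeriv_polyFun, partialDeriv, partialDeriv,
        fderiv_fun_sub hX.differentiableAt (differentiableAt_polyFun q X)]
      rfl
    refine (IsBigO.trans ?_ h).congr' hev.symm EventuallyEq.rfl
    refine IsBigO.of_bound ‖basisVec 𝕜 i‖ (Eventually.of_forall fun X => ?_)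
    rw [mul_comm]
    exact ContinuousLinearMap.le_opNorm _ _

end Expansion

/-! ### Calculus, uniqueness and faithfulness of expansions -/

section HasExpansion

open Asymptotics Filter

variable {𝕜 : Type*} [RCLike 𝕜]

/-- `φ` is the expansion of `f` at the origin in powers of the dilation parameter. -/
def HasExpansion (f : Phase 𝕜 → 𝕜) (φ : PowerSeries (MvPolynomial Idx 𝕜)) : Prop :=
  ∀ N : ℕ, ∃ q : MvPolynomial Idx 𝕜,
    PowerSeries.X ^ N ∣ φ - (scalePoly q : PowerSeries (MvPolynomial Idx 𝕜)) ∧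
    (fun X => f X - polyFun q X) =O[𝓝 0] fun X => ‖X‖ ^ N

lemma hasExpansion_polyFun (q : MvPolynomial Idx 𝕜) :
    HasExpansion (polyFun q) (scalePoly q : PowerSeries (MvPolynomial Idx 𝕜)) :=
  fun _ => ⟨q, by simp, by simpa using isBigO_zero _ _⟩

lemma polyFun_isBigO_one (q : MvPolynomial Idx 𝕜) :
    polyFun q =O[𝓝 (0 : Phase 𝕜)] fun _ => (1 : ℝ) :=
  (analyticAt_polyFun q 0).continuousAt.isBigO_one ℝ

lemma HasExpansion.congr {f g : Phase 𝕜 → 𝕜} {φ : PowerSeries (MvPolynomial Idx 𝕜)}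
    (hf : HasExpansion f φ) (h : f =ᶠ[𝓝 0] g) : HasExpansion g φ := fun N => by
  obtain ⟨q, h1, h2⟩ := hf N
  exact ⟨q, h1, h2.congr' (h.mono fun X hX => by simp only [hX]) EventuallyEq.rfl⟩

lemma HasExpansion.isBigO_one {f : Phase 𝕜 → 𝕜} {φ : PowerSeries (MvPolynomial Idx 𝕜)}
    (hf : HasExpansion f φ) : f =O[𝓝 0] fun _ => (1 : ℝ) := by
  obtain ⟨q, -, h⟩ := hf 0
  simp only [pow_zero] at h
  simpa using h.add (polyFun_isBigO_one q)

lemma HasExpansion.add {f g : Phase 𝕜 → 𝕜} {φ ψ : PowerSeries (MvPolynomial Idx 𝕜)}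
    (hf : HasExpansion f φ) (hg : HasExpansion g ψ) :
    HasExpansion (fun X => f X + g X) (φ + ψ) := fun N => by
  obtain ⟨p, hp1, hp2⟩ := hf N
  obtain ⟨q, hq1, hq2⟩ := hg N
  refine ⟨p + q, ?_, ?_⟩
  · convert dvd_add hp1 hq1 using 1
    rw [map_add, Polynomial.coe_add]
    ring
  · refine (hp2.add hq2).congr_left fun X => ?_
    simp only [polyFun, map_add]
    ring

lemma HasExpansion.mul {f g : Phase 𝕜 → 𝕜} {φ ψ : PowerSeries (MvPolynomial Idx 𝕜)}
    (hf : HasExpansion f φ) (hg : HasExpansion g ψ) :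
    HasExpansion (fun X => f X * g X) (φ * ψ) := fun N => by
  obtain ⟨p, hp1, hp2⟩ := hf N
  obtain ⟨q, hq1, hq2⟩ := hg N
  refine ⟨p * q, ?_, ?_⟩
  · convert dvd_add (Dvd.dvd.mul_right hp1 ψ)
      (Dvd.dvd.mul_left hq1 (scalePoly p : PowerSeries (MvPolynomial Idx 𝕜))) using 1
    rw [map_mul, Polynomial.coe_mul]
    ring
  · have h := (hp2.mul hg.isBigO_one).add ((hq2.mul (polyFun_isBigO_one p)))
    simp only [mul_one] at h
    refine h.congr_left fun X => ?_
    simp only [polyFun, map_mul]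
    ring

lemma hasExpansion_const (c : 𝕜) :
    HasExpansion (fun _ => c) (PowerSeries.C (MvPolynomial.C c)) := by
  have := hasExpansion_polyFun (MvPolynomial.C c)
  have hc : polyFun (MvPolynomial.C c) = fun _ : Phase 𝕜 => c := by
    ext X
    simp [polyFun]
  rw [hc] at this
  simpa [scalePoly, Polynomial.algebraMap_apply, MvPolynomial.algebraMap_eq] using this

lemma HasExpansion.sub {f g : Phase 𝕜 → 𝕜} {φ ψ : PowerSeries (MvPolynomial Idx 𝕜)}
    (hf : HasExpansion f φ) (hg : HasExpansion g ψ) :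
    HasExpansion (fun X => f X - g X) (φ - ψ) := by
  have h := hf.add ((hasExpansion_const (-1)).mul hg)
  simp only [map_neg, map_one] at h
  convert h using 1
  · ext X; ring
  · ring

lemma HasExpansion.sum {ι : Type*} (s : Finset ι) {f : ι → Phase 𝕜 → 𝕜}
    {φ : ι → PowerSeries (MvPolynomial Idx 𝕜)} (h : ∀ i, HasExpansion (f i) (φ i)) :
    HasExpansion (fun X => ∑ i ∈ s, f i X) (∑ i ∈ s, φ i) := by
  classical
  induction s using Finset.induction_on with
  | empty => simpa using hasExpansion_const (𝕜 := 𝕜) 0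
  | insert a s ha ih =>
    simp only [Finset.sum_insert ha]
    exact (h a).add ih

lemma HasExpansion.prod {ι : Type*} (s : Finset ι) {f : ι → Phase 𝕜 → 𝕜}
    {φ : ι → PowerSeries (MvPolynomial Idx 𝕜)} (h : ∀ i, HasExpansion (f i) (φ i)) :
    HasExpansion (fun X => ∏ i ∈ s, f i X) (∏ i ∈ s, φ i) := by
  classical
  induction s using Finset.induction_on with
  | empty => simpa using hasExpansion_const (𝕜 := 𝕜) 1
  | insert a s ha ih =>
    simp only [Finset.prod_insert ha]
    exact (h a).mul ih

lemma HasExpansion.det {n : Type*} [Fintype n] [DecidableEq n] {f : n → n → Phase 𝕜 → 𝕜}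
    {φ : n → n → PowerSeries (MvPolynomial Idx 𝕜)} (h : ∀ i j, HasExpansion (f i j) (φ i j)) :
    HasExpansion (fun X => (Matrix.of fun i j => f i j X).det) (Matrix.of φ).det := by
  simp only [Matrix.det_apply', Matrix.of_apply]
  refine HasExpansion.sum _ fun σ => HasExpansion.mul ?_ (HasExpansion.prod _ fun i => h _ _)
  have := hasExpansion_const (𝕜 := 𝕜) ((Equiv.Perm.sign σ : ℤ) : 𝕜)
  simpa using this

lemma norm_dilate_isBigO (X : Phase 𝕜) :
    (fun ε : 𝕜 => ‖dilate ε X‖) =O[𝓝 0] fun ε => ‖ε‖ := by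
  refine IsBigO.of_bound ‖X‖ ?_
  filter_upwards [Metric.ball_mem_nhds (0 : 𝕜) one_pos] with ε hε
  have hε1 : ‖ε‖ ≤ 1 := by simpa using (mem_ball_zero_iff.1 hε).le
  rw [norm_norm, norm_norm, dilate, Prod.norm_def, max_le_iff, norm_smul, norm_smul, norm_pow]
  constructor
  · rw [mul_comm]
    exact mul_le_mul_of_nonneg_right (norm_fst_le X) (norm_nonneg _)
  · rw [mul_comm]
    refine mul_le_mul (norm_snd_le X) ?_ (by positivity) (norm_nonneg _)
    nlinarith [norm_nonneg ε]

lemma tendsto_dilate (X : Phase 𝕜) : Tendsto (fun ε : 𝕜 => dilate ε X) (𝓝 0) (𝓝 0) := by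
  have : Continuous fun ε : 𝕜 => dilate ε X := by unfold dilate; fun_prop
  simpa [dilate] using! this.tendsto 0

lemma isBigO_dilate {f : Phase 𝕜 → 𝕜} {N : ℕ} (hf : f =O[𝓝 0] fun X => ‖X‖ ^ N)
    (X : Phase 𝕜) : (fun ε : 𝕜 => f (dilate ε X)) =O[𝓝 0] fun ε => ‖ε‖ ^ N :=
  (hf.comp_tendsto (tendsto_dilate X)).trans ((norm_dilate_isBigO X).pow N)

/-- A polynomial of size `O(ε ^ N)` at the origin is divisible by `X ^ N`. -/
lemma X_pow_dvd_of_isBigO (g : Polynomial 𝕜) (N : ℕ)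
    (h : (fun ε : 𝕜 => g.eval ε) =O[𝓝 0] fun ε => ‖ε‖ ^ N) : Polynomial.X ^ N ∣ g := by
  induction N with
  | zero => simp
  | succ N ih =>
    obtain ⟨k, hk⟩ := ih (h.trans (IsBigO.of_bound 1 (by
      filter_upwards [Metric.ball_mem_nhds (0 : 𝕜) one_pos] with ε hε
      have hε1 : ‖ε‖ ≤ 1 := by simpa using (mem_ball_zero_iff.1 hε).le
      simp only [norm_pow, norm_norm, one_mul]
      exact pow_le_pow_of_le_one (norm_nonneg _) hε1 (Nat.le_succ N))))
    have hk0 : k.eval 0 = 0 := by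
      have h1 : (fun ε : 𝕜 => k.eval ε) =O[𝓝[≠] 0] fun ε => ‖ε‖ := by
        obtain ⟨C, hC⟩ := (h.mono (nhdsWithin_le_nhds (s := {0}ᶜ))).bound
        refine IsBigO.of_bound C ?_
        filter_upwards [hC, self_mem_nhdsWithin] with ε hε hne
        have hpos : 0 < ‖ε‖ ^ N := pow_pos (norm_pos_iff.2 hne) _
        rw [hk] at hε
        simp only [Polynomial.eval_mul, Polynomial.eval_pow, Polynomial.eval_X, norm_mul, norm_pow,
          norm_norm] at hε
        rw [norm_norm]
        refine le_of_mul_le_mul_left ?_ hpos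
        calc _ ≤ _ := hε
          _ = _ := by ring
      have h2 : Tendsto (fun ε : 𝕜 => ‖ε‖) (𝓝[≠] 0) (𝓝 0) := by
        simpa using (continuous_norm.tendsto (0 : 𝕜)).mono_left nhdsWithin_le_nhds
      have h3 := h1.trans_tendsto h2
      have h4 : Tendsto (fun ε : 𝕜 => k.eval ε) (𝓝[≠] 0) (𝓝 (k.eval 0)) :=
        (k.continuous.tendsto 0).mono_left nhdsWithin_le_nhds
      exact tendsto_nhds_unique h4 h3
    obtain ⟨l, hl⟩ := Polynomial.X_dvd_iff.2
      (by rwa [Polynomial.coeff_zero_eq_eval_zero] : k.coeff 0 = 0)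
    exact ⟨l, by rw [hk, hl]; ring⟩

lemma coe_X_pow_dvd_iff {A : Type*} [CommRing A] (p : Polynomial A) (N : ℕ) :
    PowerSeries.X ^ N ∣ (p : PowerSeries A) ↔ Polynomial.X ^ N ∣ p := by
  rw [PowerSeries.X_pow_dvd_iff, Polynomial.X_pow_dvd_iff]
  simp

lemma coords_surjective {R : Type*} (v : Idx → R) : ∃ X : Phase R, coords X = v :=
  ⟨(fun i => v (Sum.inl i), fun i => v (Sum.inr i)), by ext (i | i) <;> rfl⟩

lemma X_pow_dvd_scalePoly_of_dilate {q : MvPolynomial Idx 𝕜} {N : ℕ}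
    (h : ∀ X : Phase 𝕜, (fun ε : 𝕜 => polyFun q (dilate ε X)) =O[𝓝 0] fun ε => ‖ε‖ ^ N) :
    PowerSeries.X ^ N ∣ (scalePoly q : PowerSeries (MvPolynomial Idx 𝕜)) := by
  rw [coe_X_pow_dvd_iff, Polynomial.X_pow_dvd_iff]
  intro n hn
  apply MvPolynomial.funext
  intro v
  obtain ⟨X, rfl⟩ := coords_surjective v
  have := h X
  simp only [polyFun_dilate] at this
  have h2 := Polynomial.X_pow_dvd_iff.1 (X_pow_dvd_of_isBigO _ N this) n hn
  simpa using h2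

/-- All weights are at least one, so the dilated point is `O(ε)`, and a bound in the ordinary norm
becomes a bound on the weighted order. -/
lemma X_pow_dvd_scalePoly {q : MvPolynomial Idx 𝕜} {N : ℕ}
    (h : polyFun q =O[𝓝 (0 : Phase 𝕜)] fun X => ‖X‖ ^ N) :
    PowerSeries.X ^ N ∣ (scalePoly q : PowerSeries (MvPolynomial Idx 𝕜)) :=
  X_pow_dvd_scalePoly_of_dilate fun X => isBigO_dilate h X

lemma isBigO_polyFun_dilate {q : MvPolynomial Idx 𝕜} {N : ℕ}
    (h : PowerSeries.X ^ N ∣ (scalePoly q : PowerSeries (MvPolynomial Idx 𝕜))) (X : Phase 𝕜) :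
    (fun ε : 𝕜 => polyFun q (dilate ε X)) =O[𝓝 0] fun ε => ‖ε‖ ^ N := by
  rw [coe_X_pow_dvd_iff] at h
  obtain ⟨k, hk⟩ := h
  simp only [polyFun_dilate, hk, Polynomial.map_mul, Polynomial.map_pow, Polynomial.map_X,
    Polynomial.eval_mul, Polynomial.eval_pow, Polynomial.eval_X]
  have h1 : (fun ε : 𝕜 => (k.map (MvPolynomial.eval (coords X))).eval ε) =O[𝓝 0]
      fun _ => (1 : ℝ) := (Polynomial.continuous _).continuousAt.isBigO_one ℝ
  have h2 : (fun ε : 𝕜 => ε ^ N) =O[𝓝 0] fun ε => ‖ε‖ ^ N :=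
    IsBigO.of_bound 1 (Eventually.of_forall fun ε => by simp)
  simpa using h2.mul h1

lemma powerSeries_ext_of_dvd {A : Type*} [CommRing A] {φ ψ : PowerSeries A}
    (h : ∀ N, PowerSeries.X ^ N ∣ φ - ψ) : φ = ψ := by
  ext n
  have := PowerSeries.X_pow_dvd_iff.1 (h (n + 1)) n (Nat.lt_succ_self n)
  rwa [map_sub, sub_eq_zero] at this

/-- Two approximating polynomials differ by `O(‖X‖ ^ N)`, hence agree modulo `X ^ N` after scaling.
Through uniqueness, identities between functions become identities between series. -/
lemma HasExpansion.unique {f : Phase 𝕜 → 𝕜} {φ ψ : PowerSeries (MvPolynomial Idx 𝕜)}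
    (hφ : HasExpansion f φ) (hψ : HasExpansion f ψ) : φ = ψ := by
  refine powerSeries_ext_of_dvd fun N => ?_
  obtain ⟨p, hp1, hp2⟩ := hφ N
  obtain ⟨q, hq1, hq2⟩ := hψ N
  have h : polyFun (p - q) =O[𝓝 (0 : Phase 𝕜)] fun X => ‖X‖ ^ N := by
    refine (hq2.sub hp2).congr_left fun X => ?_
    simp only [polyFun, map_sub]
    ring
  have h2 := X_pow_dvd_scalePoly h
  rw [map_sub, Polynomial.coe_sub] at h2
  convert dvd_add (dvd_sub hp1 hq1) h2 using 1
  ring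

/-- An analytic function has an expansion, and so have its partial derivatives. -/
lemma exists_hasExpansion {f : Phase 𝕜 → 𝕜} (hf : AnalyticAt 𝕜 f 0) :
    ∃ φ, HasExpansion f φ := by
  choose t ht _ using exists_taylor_polynomial hf
  have hstab : ∀ m n, m ≤ n → PowerSeries.X ^ (m + 1) ∣
      (scalePoly (t n) : PowerSeries (MvPolynomial Idx 𝕜))
        - (scalePoly (t m) : PowerSeries (MvPolynomial Idx 𝕜)) := by
    intro m n hmn
    have h : polyFun (t n - t m) =O[𝓝 (0 : Phase 𝕜)] fun X => ‖X‖ ^ (m + 1) := by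
      have h1 : (fun X : Phase 𝕜 => ‖X‖ ^ (n + 1)) =O[𝓝 0] fun X => ‖X‖ ^ (m + 1) := by
        refine IsBigO.of_bound 1 ?_
        filter_upwards [Metric.ball_mem_nhds (0 : Phase 𝕜) one_pos] with X hX
        have hX1 : ‖X‖ ≤ 1 := by simpa using (mem_ball_zero_iff.1 hX).le
        simp only [norm_pow, norm_norm, one_mul]
        exact pow_le_pow_of_le_one (norm_nonneg _) hX1 (by omega)
      refine ((ht m).sub ((ht n).trans h1)).congr_left fun X => ?_
      simp only [polyFun, map_sub]
      ring
    have := X_pow_dvd_scalePoly h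
    rwa [map_sub, Polynomial.coe_sub] at this
  -- The `n`-th coefficient is taken from `t n`; by `hstab` no later Taylor polynomial changes it.
  refine ⟨PowerSeries.mk fun n => (scalePoly (t n)).coeff n, fun N => ⟨t N, ?_, ?_⟩⟩
  · rw [PowerSeries.X_pow_dvd_iff]
    intro n hn
    have := PowerSeries.X_pow_dvd_iff.1 (hstab n N hn.le) n (Nat.lt_succ_self n)
    simp only [map_sub, Polynomial.coeff_coe, PowerSeries.coeff_mk] at this ⊢
    rw [← neg_eq_zero, neg_sub, this]
  · refine (ht N).trans (IsBigO.of_bound 1 ?_)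
    filter_upwards [Metric.ball_mem_nhds (0 : Phase 𝕜) one_pos] with X hX
    have hX1 : ‖X‖ ≤ 1 := by simpa using (mem_ball_zero_iff.1 hX).le
    simp only [norm_pow, norm_norm, one_mul]
    exact pow_le_pow_of_le_one (norm_nonneg _) hX1 (by omega)

lemma coeffwise_pderiv_scalePoly {K : Type*} [Field K] (q : MvPolynomial Idx K) (i : Idx) :
    coeffwise (MvPolynomial.pderiv i) (scalePoly q : PowerSeries (MvPolynomial Idx K))
      = PowerSeries.X ^ wt i * (scalePoly (MvPolynomial.pderiv i q) : PowerSeries _) := by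
  classical
  have hX : ∀ m, coeffwise (MvPolynomial.pderiv (R := K) i)
      (PowerSeries.X ^ m : PowerSeries (MvPolynomial Idx K)) = 0 := fun m => by
    ext1 n
    rw [coeff_coeffwise, PowerSeries.coeff_X_pow]
    split_ifs <;> simp
  have hC : ∀ a, coeffwise (MvPolynomial.pderiv (R := K) i) (PowerSeries.C a)
      = PowerSeries.C (MvPolynomial.pderiv i a) := fun a => by
    ext1 n
    rw [coeff_coeffwise, PowerSeries.coeff_C, PowerSeries.coeff_C]
    split_ifs <;> simp
  induction q using MvPolynomial.induction_on with
  | C a =>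
    simp [scalePoly, Polynomial.algebraMap_apply, MvPolynomial.algebraMap_eq, hC]
  | add p q hp hq => simp only [map_add, Polynomial.coe_add, hp, hq, mul_add]
  | mul_X p j hp =>
    have h1 : (scalePoly (MvPolynomial.X (R := K) j) : PowerSeries (MvPolynomial Idx K))
        = PowerSeries.C (MvPolynomial.X j) * PowerSeries.X ^ wt j := by simp [scalePoly]
    simp only [map_mul, Polynomial.coe_mul, Derivation.leibniz, hp, smul_eq_mul, map_add,
      Polynomial.coe_add, h1, hX, hC, MvPolynomial.pderiv_X, Pi.single_apply]
    split_ifs with hij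
    · subst hij
      simp only [map_one, Polynomial.coe_one]
      ring
    · simp only [map_zero, Polynomial.coe_zero]
      ring

/-- The chain rule: differentiating `f (dilate ε X)` in the `i`-th coordinate of `X` brings out `ε ^
wt i`. -/
lemma HasExpansion.partialDeriv {f : Phase 𝕜 → 𝕜} (hf : AnalyticAt 𝕜 f 0) {i : Idx}
    {φ ψ : PowerSeries (MvPolynomial Idx 𝕜)} (hφ : HasExpansion f φ)
    (hψ : HasExpansion (partialDeriv i f) ψ) :
    coeffwise (MvPolynomial.pderiv i) φ = PowerSeries.X ^ wt i * ψ := by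
  have hdvd : ∀ (N : ℕ) (a : PowerSeries (MvPolynomial Idx 𝕜)), PowerSeries.X ^ N ∣ a →
      PowerSeries.X ^ N ∣ coeffwise (MvPolynomial.pderiv (R := 𝕜) i) a := fun N a ha => by
    rw [PowerSeries.X_pow_dvd_iff] at ha ⊢
    intro n hn
    rw [coeff_coeffwise, ha n hn, map_zero]
  refine powerSeries_ext_of_dvd fun N => ?_
  obtain ⟨q, hq1, hq2⟩ := exists_taylor_polynomial hf N
  obtain ⟨p, hp1, hp2⟩ := hφ N
  obtain ⟨p', hp1', hp2'⟩ := hψ N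
  have hle : (fun X : Phase 𝕜 => ‖X‖ ^ (N + 1)) =O[𝓝 0] fun X => ‖X‖ ^ N := by
    refine IsBigO.of_bound 1 ?_
    filter_upwards [Metric.ball_mem_nhds (0 : Phase 𝕜) one_pos] with X hX
    have hX1 : ‖X‖ ≤ 1 := by simpa using (mem_ball_zero_iff.1 hX).le
    simp only [norm_pow, norm_norm, one_mul]
    exact pow_le_pow_of_le_one (norm_nonneg _) hX1 (by omega)
  have h1 : polyFun (p - q) =O[𝓝 (0 : Phase 𝕜)] fun X => ‖X‖ ^ N := by
    refine ((hq1.trans hle).sub hp2).congr_left fun X => ?_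
    simp only [polyFun, map_sub]
    ring
  have h2 : polyFun (MvPolynomial.pderiv i q - p') =O[𝓝 (0 : Phase 𝕜)] fun X => ‖X‖ ^ N := by
    refine (hp2'.sub (hq2 i)).congr_left fun X => ?_
    simp only [polyFun, map_sub]
    ring
  have h3 := X_pow_dvd_scalePoly h1
  have h4 := X_pow_dvd_scalePoly h2
  rw [map_sub, Polynomial.coe_sub] at h3 h4
  have h5 := hdvd N _ (dvd_add hp1 h3)
  have h6 : PowerSeries.X ^ N ∣ PowerSeries.X ^ wt i * (ψ - (scalePoly (MvPolynomial.pderiv i q) :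
      PowerSeries (MvPolynomial Idx 𝕜))) := by
    refine Dvd.dvd.mul_left ?_ _
    convert dvd_sub hp1' h4 using 1
    ring
  convert dvd_sub h5 h6 using 1
  rw [map_add, map_sub, map_sub, coeffwise_pderiv_scalePoly q]
  ring

/-- An analytic function with zero expansion vanishes near the origin. -/
lemma eventuallyEq_zero_of_hasExpansion_zero {f : Phase 𝕜 → 𝕜} (hf : AnalyticAt 𝕜 f 0)
    (h : HasExpansion f 0) : f =ᶠ[𝓝 0] 0 := by
  obtain ⟨r, hr, hball⟩ := Metric.eventually_nhds_iff_ball.1 hf.eventually_analyticAt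
  filter_upwards [Metric.ball_mem_nhds (0 : Phase 𝕜) hr] with X hX
  have hmem : ∀ ε ∈ Metric.closedBall (0 : 𝕜) 1, dilate ε X ∈ Metric.ball (0 : Phase 𝕜) r := by
    intro ε hε
    have hε1 : ‖ε‖ ≤ 1 := by simpa using hε
    rw [mem_ball_zero_iff] at hX ⊢
    refine lt_of_le_of_lt ?_ hX
    rw [dilate, Prod.norm_def, max_le_iff, norm_smul, norm_smul, norm_pow]
    exact ⟨(mul_le_of_le_one_left (norm_nonneg _) hε1).trans (norm_fst_le X),
      (mul_le_of_le_one_left (norm_nonneg _) (pow_le_one₀ (norm_nonneg _) hε1)).trans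
        (norm_snd_le X)⟩
  -- The dilation curve joins `0` to `X`. Along it `f` vanishes to infinite order at `ε = 0`, so the
  -- identity theorem on the unit ball gives `f X = 0` at `ε = 1`.
  have hg : AnalyticOnNhd 𝕜 (fun ε : 𝕜 => f (dilate ε X)) (Metric.closedBall 0 1) := by
    intro ε hε
    have hd : AnalyticAt 𝕜 (fun ε : 𝕜 => dilate ε X) ε := by
      have h1 : AnalyticAt 𝕜 (fun ε : 𝕜 => ε • X.1) ε := analyticAt_id.smul analyticAt_const
      have h2 : AnalyticAt 𝕜 (fun ε : 𝕜 => ε ^ 2 • X.2) ε :=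
        (analyticAt_id.pow 2).smul analyticAt_const
      exact h1.prod h2
    exact (hball _ (hmem ε hε)).comp_of_eq hd rfl
  have h0mem : (0 : 𝕜) ∈ Metric.closedBall (0 : 𝕜) 1 := by simp
  have hzero : (fun ε : 𝕜 => f (dilate ε X)) =ᶠ[𝓝 0] 0 := by
    by_contra hne
    obtain ⟨n, g, hg1, hg0, hgn⟩ :=
      (hg 0 h0mem).exists_eventuallyEq_pow_smul_nonzero_iff.2 hne
    obtain ⟨q, hq1, hq2⟩ := h (n + 1)
    rw [zero_sub, dvd_neg] at hq1
    have hO : (fun ε : 𝕜 => f (dilate ε X)) =O[𝓝 0] fun ε => ‖ε‖ ^ (n + 1) := by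
      simpa using (isBigO_dilate hq2 X).add (isBigO_polyFun_dilate hq1 X)
    have hgO : g =O[𝓝[≠] 0] fun ε => ‖ε‖ := by
      obtain ⟨C, hC⟩ := (hO.mono (nhdsWithin_le_nhds (s := {0}ᶜ))).bound
      refine IsBigO.of_bound C ?_
      filter_upwards [hC, self_mem_nhdsWithin, nhdsWithin_le_nhds hgn] with ε hε hne hgε
      have hpos : 0 < ‖ε‖ ^ n := pow_pos (norm_pos_iff.2 hne) _
      rw [hgε] at hε
      simp only [sub_zero, norm_smul, norm_pow, norm_norm] at hε
      rw [norm_norm]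
      refine le_of_mul_le_mul_left ?_ hpos
      calc _ ≤ _ := hε
        _ = _ := by ring
    have h2 : Tendsto (fun ε : 𝕜 => ‖ε‖) (𝓝[≠] 0) (𝓝 0) := by
      simpa using (continuous_norm.tendsto (0 : 𝕜)).mono_left nhdsWithin_le_nhds
    have h4 : Tendsto g (𝓝[≠] 0) (𝓝 (g 0)) := hg1.continuousAt.tendsto.mono_left nhdsWithin_le_nhds
    exact hg0 (tendsto_nhds_unique h4 (hgO.trans_tendsto h2))
  have h1 := hg.eqOn_zero_of_preconnected_of_eventuallyEq_zero
    (convex_closedBall (0 : 𝕜) 1).isPreconnected h0mem hzero (by simp : (1 : 𝕜) ∈ _)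
  simpa [dilate] using! h1

end HasExpansion

/-! ### Maximal minors and cofactors -/

section LinearAlgebra

/-- Linearly independent rows have a nonvanishing maximal minor. -/
lemma exists_minor_ne_zero {L ι : Type*} [Field L] [Fintype ι] {n : ℕ} (M : Fin n → ι → L)
    (hM : LinearIndependent L M) :
    ∃ τ : Fin n → ι, (Matrix.of fun i j => M i (τ j)).det ≠ 0 := by
  have hrank : (Matrix.of M).rank = n := by
    have := LinearIndependent.rank_matrix (M := Matrix.of M) hM
    simpa using this
  obtain ⟨f, hf, -, hli⟩ := Submodule.exists_fun_fin_finrank_span_eq L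
    (Set.range (Matrix.of M).col)
  have hn := (Matrix.rank_eq_finrank_span_cols (Matrix.of M)).symm.trans hrank
  choose τ' hτ' using hf
  let τ : Fin n → ι := fun j => τ' (Fin.cast hn.symm j)
  have hτ : ∀ j, (Matrix.of M).col (τ j) = f (Fin.cast hn.symm j) := fun j => hτ' _
  refine ⟨τ, ?_⟩
  have h : LinearIndependent L (Matrix.of fun i j => M i (τ j)).col := by
    have he : (Matrix.of fun i j => M i (τ j)).col = f ∘ Fin.cast hn.symm := by
      ext j i
      rw [Function.comp_apply, ← hτ j]
      rfl
    rw [he]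
    exact hli.comp _ (Fin.cast_injective _)
  have := Matrix.linearIndependent_cols_iff_isUnit.1 h
  exact ((Matrix.isUnit_iff_isUnit_det _).1 this).ne_zero

lemma linearIndependent_of_minor_ne_zero {L ι : Type*} [Field L] {n : ℕ} (M : Fin n → ι → L)
    (τ : Fin n → ι) (h : (Matrix.of fun i j => M i (τ j)).det ≠ 0) : LinearIndependent L M :=
  LinearIndependent.of_comp (LinearMap.funLeft L L τ)
    (Matrix.linearIndependent_rows_of_det_ne_zero h)

/-- The determinant as a linear function of its last row. -/
lemma exists_det_eq_sum_last_row {R : Type*} [CommRing R] (α β γ : Fin 4 → R) :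
    ∃ c : Fin 4 → R, ∀ δ : Fin 4 → R,
      (Matrix.of fun i j => ![α j, β j, γ j, δ j] i).det = ∑ j, c j * δ j := by
  refine ⟨fun j => (-1) ^ (3 + (j : ℕ)) * ((Matrix.of fun i j => ![α j, β j, γ j, 0] i).submatrix
    (Fin.succAbove 3) (Fin.succAbove j)).det, fun δ => ?_⟩
  rw [Matrix.det_succ_row _ 3]
  refine Finset.sum_congr rfl fun j _ => ?_
  have h : (Matrix.of fun i j => ![α j, β j, γ j, δ j] i).submatrix
      (Fin.succAbove 3) (Fin.succAbove j) = (Matrix.of fun i j => ![α j, β j, γ j, 0] i).submatrix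
      (Fin.succAbove 3) (Fin.succAbove j) := by
    ext i k
    fin_cases i <;> rfl
  rw [h]
  simp only [Matrix.of_apply, Matrix.cons_val]
  have h3 : ((3 : Fin 4) : ℕ) = 3 := rfl
  rw [h3]
  ring

end LinearAlgebra

/-! ### The weighted Euler derivation -/

section EulerDerivation

/-- The derivation `ε d/dε - ∑ wt i • x i • d i` of power series in `ε`; it kills expansions. -/
def eulerDerivation {K A : Type*} [CommRing K] [CommRing A] [Algebra K A] (x : Idx → A)
    (d : Idx → Derivation K A A) : Derivation K (PowerSeries A) (PowerSeries A) :=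
  (PowerSeries.X : PowerSeries A) • (PowerSeries.derivative A).restrictScalars K
    - ∑ i, (PowerSeries.C ((wt i : A) * x i)) • coeffwise (d i)

lemma derivation_sum_apply {K R ι : Type*} [CommRing K] [CommRing R] [Algebra K R]
    (s : Finset ι) (c : ι → R) (d : ι → Derivation K R R) (z : R) :
    (∑ i ∈ s, c i • d i) z = ∑ i ∈ s, c i * d i z := by
  rw [← Derivation.coeFnAddMonoidHom_apply, map_sum, Finset.sum_apply]
  rfl

lemma coeff_eulerDerivation {K A : Type*} [CommRing K] [CommRing A] [Algebra K A] (x : Idx → A)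
    (d : Idx → Derivation K A A) (z : PowerSeries A) (n : ℕ) :
    PowerSeries.coeff n (eulerDerivation x d z)
      = n * PowerSeries.coeff n z - ∑ i, wt i * x i * d i (PowerSeries.coeff n z) := by
  rw [eulerDerivation, Derivation.sub_apply, derivation_sum_apply, map_sub, map_sum]
  congr 1
  · change PowerSeries.coeff n (PowerSeries.X * PowerSeries.derivative A z) = _
    cases n with
    | zero => simp
    | succ n =>
      rw [PowerSeries.coeff_succ_X_mul, PowerSeries.coeff_derivative]
      push_cast
      ring
  · refine Finset.sum_congr rfl fun i _ => ?_
    rw [PowerSeries.coeff_C_mul, coeff_coeffwise]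

/-- A derivation need only be checked on generators, and the generator `X_j ε ^ wt j` is
homogeneous. Being killed means that each coefficient at `ε ^ n` has weight `n`. -/
lemma eulerDerivation_scalePoly {K : Type*} [Field K] (q : MvPolynomial Idx K) :
    eulerDerivation (K := K) MvPolynomial.X MvPolynomial.pderiv
      (scalePoly q : PowerSeries (MvPolynomial Idx K)) = 0 := by
  classical
  have hmul : ∀ j, eulerDerivation (K := K) MvPolynomial.X MvPolynomial.pderiv
      (scalePoly (MvPolynomial.X (R := K) j) : PowerSeries (MvPolynomial Idx K)) = 0 := by
    intro j
    ext1 n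
    rw [coeff_eulerDerivation]
    have h1 : PowerSeries.coeff n (scalePoly (MvPolynomial.X (R := K) j) :
        PowerSeries (MvPolynomial Idx K)) = if n = wt j then MvPolynomial.X j else 0 := by
      rw [Polynomial.coeff_coe]
      simp [scalePoly, Polynomial.coeff_X_pow]
    rw [h1]
    split_ifs with hn
    · rw [Finset.sum_eq_single_of_mem j (Finset.mem_univ j)]
      · simp [hn]
      · intro i _ hi
        rw [MvPolynomial.pderiv_X_of_ne hi.symm, mul_zero]
    · simp
  induction q using MvPolynomial.induction_on with
  | C a =>
    have : (scalePoly (MvPolynomial.C (σ := Idx) a) : PowerSeries (MvPolynomial Idx K))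
        = algebraMap K _ a := by
      simp [scalePoly, Polynomial.algebraMap_apply, MvPolynomial.algebraMap_eq,
        PowerSeries.algebraMap_apply]
    rw [this, Derivation.map_algebraMap]
  | add p q hp hq => rw [map_add, Polynomial.coe_add, map_add, hp, hq, add_zero]
  | mul_X p j hp =>
    rw [map_mul, Polynomial.coe_mul, Derivation.leibniz, hp, hmul, smul_zero, smul_zero, add_zero]

lemma HasExpansion.eulerDerivation_eq_zero {𝕜 : Type*} [RCLike 𝕜] {f : Phase 𝕜 → 𝕜}
    {φ : PowerSeries (MvPolynomial Idx 𝕜)} (hf : HasExpansion f φ) :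
    eulerDerivation (K := 𝕜) MvPolynomial.X MvPolynomial.pderiv φ = 0 := by
  refine powerSeries_ext_of_dvd fun N => ?_
  obtain ⟨q, hq, -⟩ := hf N
  rw [← eulerDerivation_scalePoly q, ← map_sub, PowerSeries.X_pow_dvd_iff]
  rw [PowerSeries.X_pow_dvd_iff] at hq
  intro n hn
  rw [coeff_eulerDerivation, hq n hn]
  simp

end EulerDerivation

/-! ### From power series over polynomials to a rational first integral -/

section Rational

/-- Ziglin's lemma for power series with polynomial coefficients: the leading coefficient of an
independent first integral can be taken to be an independent rational function. -/
theorem exists_rational_first_integral {K : Type*} [Field K] [CharZero K]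
    (H H' P Q : PowerSeries (MvPolynomial Idx K)) (g₁ g₂ : MvPolynomial Idx K)
    (v : Idx → PowerSeries (MvPolynomial Idx K)) (σ : Fin 4 → Idx)
    (hH : H = PowerSeries.X ^ 2 * H')
    (hTH : eulerDerivation (K := K) MvPolynomial.X MvPolynomial.pderiv H = 0)
    (hT₁ : eulerDerivation (K := K) MvPolynomial.X MvPolynomial.pderiv
      (PowerSeries.X ^ 4 * PowerSeries.C g₁) = 0)
    (hT₂ : eulerDerivation (K := K) MvPolynomial.X MvPolynomial.pderiv
      (PowerSeries.X ^ 3 * PowerSeries.C g₂) = 0)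
    (hTP : eulerDerivation (K := K) MvPolynomial.X MvPolynomial.pderiv P = 0)
    (hTQ : eulerDerivation (K := K) MvPolynomial.X MvPolynomial.pderiv Q = 0)
    (hVH : ∑ i, v i * coeffwise (MvPolynomial.pderiv (R := K) i) H = 0)
    (hV₁ : ∑ i, v i * coeffwise (MvPolynomial.pderiv (R := K) i)
      (PowerSeries.X ^ 4 * PowerSeries.C g₁) = 0)
    (hV₂ : ∑ i, v i * coeffwise (MvPolynomial.pderiv (R := K) i)
      (PowerSeries.X ^ 3 * PowerSeries.C g₂) = 0)
    (hV : ∑ i, v i * (Q * coeffwise (MvPolynomial.pderiv (R := K) i) P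
      - P * coeffwise (MvPolynomial.pderiv (R := K) i) Q) = 0)
    (hQ : Q ≠ 0)
    (hD : (Matrix.of fun i j : Fin 4 => ![coeffwise (MvPolynomial.pderiv (R := K) (σ j)) H,
      coeffwise (MvPolynomial.pderiv (R := K) (σ j)) (PowerSeries.X ^ 4 * PowerSeries.C g₁),
      coeffwise (MvPolynomial.pderiv (R := K) (σ j)) (PowerSeries.X ^ 3 * PowerSeries.C g₂),
      Q * coeffwise (MvPolynomial.pderiv (R := K) (σ j)) P
        - P * coeffwise (MvPolynomial.pderiv (R := K) (σ j)) Q] i).det ≠ 0)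
    (hind : ∃ τ : Fin 3 → Idx, (Matrix.of fun i j : Fin 3 =>
      ![MvPolynomial.pderiv (τ j) (PowerSeries.constantCoeff H'), MvPolynomial.pderiv (τ j) g₁,
        MvPolynomial.pderiv (τ j) g₂] i).det ≠ 0) :
    ∃ a b : MvPolynomial Idx K, b ≠ 0 ∧
      ∑ i, PowerSeries.constantCoeff (v i)
        * (b * MvPolynomial.pderiv i a - a * MvPolynomial.pderiv i b) = 0 ∧
      ∃ τ : Fin 4 → Idx, (Matrix.of fun i j : Fin 4 =>
        ![MvPolynomial.pderiv (τ j) (PowerSeries.constantCoeff H'), MvPolynomial.pderiv (τ j) g₁,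
          MvPolynomial.pderiv (τ j) g₂,
          b * MvPolynomial.pderiv (τ j) a - a * MvPolynomial.pderiv (τ j) b] i).det ≠ 0 := by
  classical
  let A := MvPolynomial Idx K
  let L := FractionRing A
  let m : A →+* L := algebraMap A L
  have hm : Function.Injective m := IsFractionRing.injective A L
  let Φ : PowerSeries A →+* PowerSeries L := PowerSeries.map m
  have hΦ : Function.Injective Φ := PowerSeries.map_injective m hm
  choose d hd using fun i => exists_derivation_extension (K := K) (L := L)
    (MvPolynomial.pderiv (R := K) (σ := Idx) i)
  have hdΦ : ∀ i φ, coeffwise (d i) (Φ φ) = Φ (coeffwise (MvPolynomial.pderiv i) φ) := by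
    intro i φ
    ext n
    simp only [coeff_coeffwise, Φ, PowerSeries.coeff_map]
    exact hd i _
  let x : Idx → L := fun i => m (MvPolynomial.X i)
  have halg : Algebra.IsAlgebraic A L := IsLocalization.isAlgebraic L (nonZeroDivisors A)
  have hx : IsTranscendenceBasis K x :=
    (IsTranscendenceBasis.mvPolynomial Idx K).algebraMap_comp
  have hdx : ∀ i j, d i (x j) = if i = j then 1 else 0 := by
    intro i j
    rw [hd, MvPolynomial.pderiv_X, Pi.single_apply]
    split_ifs <;> simp_all
  have hTΦ : ∀ φ, eulerDerivation x d (Φ φ)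
      = Φ (eulerDerivation (K := K) MvPolynomial.X MvPolynomial.pderiv φ) := by
    intro φ
    ext1 n
    simp only [coeff_eulerDerivation, Φ, PowerSeries.coeff_map, map_sub, map_sum, map_mul,
      map_natCast]
    congr 1
    refine Finset.sum_congr rfl fun i _ => ?_
    rw [← hd]
  let V : Derivation K (PowerSeries L) (PowerSeries L) := ∑ i, Φ (v i) • coeffwise (d i)
  have hVΦ : ∀ φ, V (Φ φ) = Φ (∑ i, v i * coeffwise (MvPolynomial.pderiv (R := K) i) φ) := by
    intro φ
    simp only [V, derivation_sum_apply, hdΦ, map_sum, map_mul]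
  -- The cofactors of the last row are the coefficients of the derivation `D`. A repeated row shows
  -- that `D` kills the first three functions, and `hD` says that it does not kill `P / Q`.
  obtain ⟨c, hc⟩ := exists_det_eq_sum_last_row
    (fun j => coeffwise (MvPolynomial.pderiv (R := K) (σ j)) H)
    (fun j => coeffwise (MvPolynomial.pderiv (R := K) (σ j))
      (PowerSeries.X ^ 4 * PowerSeries.C g₁))
    (fun j => coeffwise (MvPolynomial.pderiv (R := K) (σ j))
      (PowerSeries.X ^ 3 * PowerSeries.C g₂))
  let D : Derivation K (PowerSeries L) (PowerSeries L) := ∑ j, Φ (c j) • coeffwise (d (σ j))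
  have hDΦ : ∀ φ, D (Φ φ)
      = Φ (∑ j, c j * coeffwise (MvPolynomial.pderiv (R := K) (σ j)) φ) := by
    intro φ
    simp only [D, derivation_sum_apply, hdΦ, map_sum, map_mul]
  have hT0 : ∀ φ, eulerDerivation (K := K) MvPolynomial.X MvPolynomial.pderiv φ = 0 →
      eulerDerivation x d (Φ φ) = 0 := fun φ h => by rw [hTΦ, h, map_zero]
  have hV0 : ∀ φ, ∑ i, v i * coeffwise (MvPolynomial.pderiv (R := K) i) φ = 0 →
      V (Φ φ) = 0 := fun φ h => by rw [hVΦ, h, map_zero]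
  have hX : ∀ n φ, Φ (PowerSeries.X ^ n * φ) = PowerSeries.X ^ n * Φ φ := fun n φ => by
    simp [Φ]
  have hcc : ∀ φ, PowerSeries.constantCoeff (Φ φ) = m (PowerSeries.constantCoeff φ) := fun φ => by
    rw [← PowerSeries.coeff_zero_eq_constantCoeff_apply, PowerSeries.coeff_map,
      PowerSeries.coeff_zero_eq_constantCoeff_apply]
  have hTE : ∀ z, eulerDerivation x d z = 0 →
      ∑ i, ((wt i : L) * x i) * d i (PowerSeries.constantCoeff z) = 0 := by
    intro z hz
    have := congrArg (PowerSeries.coeff 0) hz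
    rw [coeff_eulerDerivation] at this
    simpa [-Fintype.sum_sum_type] using this
  -- Euler's identity for the leading coefficient of `H`, which has weight two: the coefficient at
  -- `ε²` of `T H = 0`.
  have hE : ∑ i, ((wt i : L) * x i) * d i (PowerSeries.constantCoeff (Φ H'))
      = 2 * PowerSeries.constantCoeff (Φ H') := by
    have h1 := congrArg (PowerSeries.coeff 2) (hT0 _ hTH)
    have h2 : PowerSeries.coeff 2 (Φ H) = PowerSeries.constantCoeff (Φ H') := by
      rw [hH, hX, PowerSeries.coeff_X_pow_mul']
      simp
    rw [coeff_eulerDerivation, h2, map_zero, sub_eq_zero] at h1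
    rw [← h1]
    norm_num
  have hΦC : ∀ g, PowerSeries.constantCoeff (Φ (PowerSeries.C g)) = m g := fun g => by
    rw [hcc, PowerSeries.constantCoeff_C]
  have hdm : ∀ i a, d i (m a) = m (MvPolynomial.pderiv i a) := hd
  have hind' : LinearIndependent L ![fun i => d i (PowerSeries.constantCoeff (Φ H')),
      fun i => d i (PowerSeries.constantCoeff (Φ (PowerSeries.C g₁))),
      fun i => d i (PowerSeries.constantCoeff (Φ (PowerSeries.C g₂)))] := by
    obtain ⟨τ, hτ⟩ := hind
    refine linearIndependent_of_minor_ne_zero _ τ ?_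
    have h2 : (Matrix.of fun i j : Fin 3 =>
        (![fun i => d i (PowerSeries.constantCoeff (Φ H')),
          fun i => d i (PowerSeries.constantCoeff (Φ (PowerSeries.C g₁))),
          fun i => d i (PowerSeries.constantCoeff (Φ (PowerSeries.C g₂)))] : Fin 3 → Idx → L)
          i (τ j)) =
        m.mapMatrix (Matrix.of fun i j : Fin 3 =>
          ![MvPolynomial.pderiv (τ j) (PowerSeries.constantCoeff H'), MvPolynomial.pderiv (τ j) g₁,
            MvPolynomial.pderiv (τ j) g₂] i) := by
      ext i j
      simp only [hΦC, hcc, hdm]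
      fin_cases i <;> rfl
    rw [h2, ← RingHom.map_det]
    exact (map_ne_zero_iff m hm).2 hτ
  have hDsub : Φ Q * D (Φ P) - Φ P * D (Φ Q) ≠ 0 := by
    rw [hc] at hD
    rw [hDΦ, hDΦ, ← map_mul, ← map_mul, ← map_sub]
    refine (map_ne_zero_iff Φ hΦ).2 ?_
    convert hD using 1
    rw [Finset.mul_sum, Finset.mul_sum, ← Finset.sum_sub_distrib]
    exact Finset.sum_congr rfl fun j _ => by ring
  have hVsub : Φ Q * V (Φ P) - Φ P * V (Φ Q) = 0 := by
    rw [hVΦ, hVΦ, ← map_mul, ← map_mul, ← map_sub]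
    convert map_zero Φ using 2
    rw [← hV, Finset.mul_sum, Finset.mul_sum, ← Finset.sum_sub_distrib]
    exact Finset.sum_congr rfl fun j _ => by ring
  have hD0 : ∀ φ, (∑ j, c j * coeffwise (MvPolynomial.pderiv (R := K) (σ j)) φ = 0) →
      D (Φ φ) = 0 := fun φ h => by rw [hDΦ, h, map_zero]
  obtain ⟨z, hVz, hz⟩ := exists_independent_leading_coeff_of_quotient x hx d hdx
    (fun i => (wt i : L) * x i) (eulerDerivation x d) V D hTE (Φ H) (Φ H')
    (Φ (PowerSeries.X ^ 4 * PowerSeries.C g₁)) (Φ (PowerSeries.C g₁))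
    (Φ (PowerSeries.X ^ 3 * PowerSeries.C g₂)) (Φ (PowerSeries.C g₂))
    (by rw [hH, hX]) (hX _ _) (hX _ _) hE (hT0 _ hTH) (hV0 _ hVH)
    (hD0 _ (by rw [← hc]; exact Matrix.det_zero_of_row_eq (i := 0) (j := 3) (by decide) rfl))
    (hT0 _ hT₁) (hV0 _ hV₁)
    (hD0 _ (by rw [← hc]; exact Matrix.det_zero_of_row_eq (i := 1) (j := 3) (by decide) rfl))
    (hT0 _ hT₂) (hV0 _ hV₂)
    (hD0 _ (by rw [← hc]; exact Matrix.det_zero_of_row_eq (i := 2) (j := 3) (by decide) rfl))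
    hind' (Φ P) (Φ Q) ((map_ne_zero_iff Φ hΦ).2 hQ) (hT0 _ hTP) (hT0 _ hTQ) hVsub hDsub
  -- The constant coefficient of `V z = 0` says that the leading field annihilates the leading
  -- coefficient `a / b`. Multiplying by `b²` gives the identities in polynomials.
  obtain ⟨a, b, hb, hab⟩ := IsFractionRing.div_surjective (A := A) (PowerSeries.constantCoeff z)
  have hb0 : b ≠ 0 := nonZeroDivisors.ne_zero hb
  have hmb : m b ≠ 0 := (map_ne_zero_iff m hm).2 hb0
  have hdz : ∀ i, m b ^ 2 * d i (PowerSeries.constantCoeff z)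
      = m (b * MvPolynomial.pderiv i a - a * MvPolynomial.pderiv i b) := by
    intro i
    rw [← hab, Derivation.leibniz_div]
    change m b ^ 2 * ((m b)⁻¹ ^ 2 * (m b * d i (m a) - m a * d i (m b))) = _
    rw [hdm, hdm, map_sub, map_mul, map_mul, ← mul_assoc, ← mul_pow, mul_inv_cancel₀ hmb, one_pow,
      one_mul]
  refine ⟨a, b, hb0, ?_, ?_⟩
  · apply hm
    have h1 := congrArg PowerSeries.constantCoeff hVz
    simp only [V, derivation_sum_apply, map_sum, map_mul, hcc, map_zero] at h1
    have h2 : ∀ i, PowerSeries.constantCoeff (coeffwise (d i) z)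
        = d i (PowerSeries.constantCoeff z) := fun i => by
      rw [← PowerSeries.coeff_zero_eq_constantCoeff_apply, coeff_coeffwise,
        PowerSeries.coeff_zero_eq_constantCoeff_apply]
    simp only [h2] at h1
    rw [map_sum, map_zero, ← mul_zero (m b ^ 2), ← h1, Finset.mul_sum]
    refine Finset.sum_congr rfl fun i _ => ?_
    rw [map_mul, ← hdz]
    ring
  · obtain ⟨τ, hτ⟩ := exists_minor_ne_zero _ hz
    refine ⟨τ, fun h0 => hτ ?_⟩
    have h1 := congrArg m h0
    rw [map_zero, RingHom.map_det] at h1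
    have h2 : m.mapMatrix (Matrix.of fun i j : Fin 4 =>
        ![MvPolynomial.pderiv (τ j) (PowerSeries.constantCoeff H'), MvPolynomial.pderiv (τ j) g₁,
          MvPolynomial.pderiv (τ j) g₂,
          b * MvPolynomial.pderiv (τ j) a - a * MvPolynomial.pderiv (τ j) b] i)
        = Matrix.of fun i j => ![1, 1, 1, m b ^ 2] i * (Matrix.of fun i j =>
          (![fun i => d i (PowerSeries.constantCoeff (Φ H')),
            fun i => d i (PowerSeries.constantCoeff (Φ (PowerSeries.C g₁))),
            fun i => d i (PowerSeries.constantCoeff (Φ (PowerSeries.C g₂))),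
            fun i => d i (PowerSeries.constantCoeff z)] : Fin 4 → Idx → L) i (τ j)) i j := by
      ext i j
      fin_cases i
      · simp [hcc, hdm]
      · simp [hΦC, hdm]
      · simp [hΦC, hdm]
      · exact (hdz (τ j)).symm
    rw [h2, Matrix.det_mul_column] at h1
    refine (mul_eq_zero.1 h1).resolve_left ?_
    simp [Fin.prod_univ_four, hmb]

end Rational

/-! ### The Lie–Poisson structure -/

section Hamiltonian

/-- The Lie-Poisson Hamiltonian vector with gradients `a` in `M` and `c` in `Γ`. -/
def hamVec {R : Type*} [CommRing R] (M Γ a c : Fin 3 → R) : Idx → R :=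
  Sum.elim (M ⨯₃ a + Γ ⨯₃ c) (Γ ⨯₃ a)

/-- Skew-symmetry of the Poisson matrix: a Hamiltonian is constant along its own field. -/
lemma sum_hamVec_mul_gradient {R : Type*} [CommRing R] (M Γ a c : Fin 3 → R) :
    ∑ i, hamVec M Γ a c i * Sum.elim a c i = 0 := by
  simp only [hamVec, Fintype.sum_sum_type, Sum.elim_inl, Sum.elim_inr, Fin.sum_univ_three,
    Pi.add_apply, cross_apply, Matrix.cons_val]
  ring

/-- The gradient `(0, 2 Γ)` of the Casimir `F₁` lies in the kernel of the Poisson matrix; in the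
next lemma the same holds for the gradient `(Γ, M)` of `F₂`. -/
lemma sum_hamVec_mul_F₁ {R : Type*} [CommRing R] (M Γ a c : Fin 3 → R) :
    ∑ i, hamVec M Γ a c i * Sum.elim (fun _ => 0) (fun j => 2 * Γ j) i = 0 := by
  simp only [hamVec, Fintype.sum_sum_type, Sum.elim_inl, Sum.elim_inr, Fin.sum_univ_three,
    Pi.add_apply, cross_apply, Matrix.cons_val]
  ring

lemma sum_hamVec_mul_F₂ {R : Type*} [CommRing R] (M Γ a c : Fin 3 → R) :
    ∑ i, hamVec M Γ a c i * Sum.elim Γ M i = 0 := by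
  simp only [hamVec, Fintype.sum_sum_type, Sum.elim_inl, Sum.elim_inr, Fin.sum_univ_three,
    Pi.add_apply, cross_apply, Matrix.cons_val]
  ring

lemma map_hamVec {R S : Type*} [CommRing R] [CommRing S] (f : R →+* S) (M Γ a c : Fin 3 → R)
    (i : Idx) : f (hamVec M Γ a c i)
      = hamVec (fun j => f (M j)) (fun j => f (Γ j)) (fun j => f (a j)) (fun j => f (c j)) i := by
  rcases i with i | i <;> fin_cases i <;> simp [hamVec, cross_apply]

variable {𝕜 : Type*} [RCLike 𝕜]

lemma coords_hamiltonianField (H : Phase 𝕜 → 𝕜) (X : Phase 𝕜) (i : Idx) :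
    coords (hamiltonianField H X) i = hamVec X.1 X.2 (fun j => partialDeriv (Sum.inl j) H X)
      (fun j => partialDeriv (Sum.inr j) H X) i := by
  rcases i with i | i <;> rfl

lemma fderiv_apply_eq_sum (f : Phase 𝕜 → 𝕜) (X V : Phase 𝕜) :
    fderiv 𝕜 f X V = ∑ i, coords V i * partialDeriv i f X := by
  conv_lhs => rw [← sum_coords_smul_basisVec V, map_sum]
  simp only [map_smul, smul_eq_mul, partialDeriv]

end Hamiltonian

/-! ### The polynomials `F₁`, `F₂`, `H₂` and their gradients -/

section Polynomials

variable {K : Type*} [Field K]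

variable (K) in
/-- The polynomial `F₁`. -/
def polyF₁ : MvPolynomial Idx K :=
  ∑ i : Fin 3, MvPolynomial.X (Sum.inr i) * MvPolynomial.X (Sum.inr i)

variable (K) in
/-- The polynomial `F₂`. -/
def polyF₂ : MvPolynomial Idx K :=
  ∑ i : Fin 3, MvPolynomial.X (Sum.inr i) * MvPolynomial.X (Sum.inl i)

/-- The quadratic-linear polynomial `½ M · B M + c · Γ`. -/
def polyH (B : Matrix (Fin 3) (Fin 3) K) (c : Fin 3 → K) : MvPolynomial Idx K :=
  MvPolynomial.C (1 / 2) * (∑ i : Fin 3, ∑ j : Fin 3,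
      MvPolynomial.C (B i j) * MvPolynomial.X (Sum.inl i) * MvPolynomial.X (Sum.inl j))
    + ∑ i : Fin 3, MvPolynomial.C (c i) * MvPolynomial.X (Sum.inr i)

lemma pderiv_polyF₁ (i : Idx) :
    MvPolynomial.pderiv i (polyF₁ K)
      = Sum.elim (fun _ => 0) (fun j => 2 * MvPolynomial.X (Sum.inr j)) i := by
  rcases i with i | i <;> fin_cases i <;>
    simp [polyF₁, Fin.sum_univ_three, MvPolynomial.pderiv_X] <;> ring

lemma pderiv_polyF₂ (i : Idx) :
    MvPolynomial.pderiv i (polyF₂ K)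
      = Sum.elim (fun j => MvPolynomial.X (Sum.inr j)) (fun j => MvPolynomial.X (Sum.inl j)) i := by
  rcases i with i | i <;> fin_cases i <;>
    simp [polyF₂, Fin.sum_univ_three, MvPolynomial.pderiv_X]

lemma pderiv_polyH [CharZero K] (B : Matrix (Fin 3) (Fin 3) K) (hB : Bᵀ = B) (c : Fin 3 → K)
    (i : Idx) :
    MvPolynomial.pderiv i (polyH B c) = Sum.elim
      (fun i => ∑ j, MvPolynomial.C (B i j) * MvPolynomial.X (Sum.inl j))
      (fun i => MvPolynomial.C (c i)) i := by
  have e1 : B 1 0 = B 0 1 := congrFun (congrFun hB 0) 1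
  have e2 : B 2 0 = B 0 2 := congrFun (congrFun hB 0) 2
  have e3 : B 2 1 = B 1 2 := congrFun (congrFun hB 1) 2
  have h2 : (MvPolynomial.C (1 / 2) : MvPolynomial Idx K) * 2 = 1 := by
    rw [← map_ofNat MvPolynomial.C 2, ← map_mul]
    simp
  rcases i with i | i
  · have key : MvPolynomial.pderiv (Sum.inl i) (polyH B c)
        = MvPolynomial.C (1 / 2)
          * (2 * ∑ j, MvPolynomial.C (B i j) * MvPolynomial.X (Sum.inl j)) := by
      fin_cases i <;>
      · simp [polyH, Fin.sum_univ_three, MvPolynomial.pderiv_X, Derivation.leibniz, -one_div,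
          e1, e2, e3]
        ring
    rw [key, ← mul_assoc, h2, one_mul, Sum.elim_inl]
  · fin_cases i <;>
    simp [polyH, Fin.sum_univ_three, MvPolynomial.pderiv_X, Derivation.leibniz]

lemma scalePoly_polyF₁ : (scalePoly (polyF₁ K) : PowerSeries (MvPolynomial Idx K))
    = PowerSeries.X ^ 4 * PowerSeries.C (polyF₁ K) := by
  simp only [polyF₁, Fin.sum_univ_three, map_add, map_mul, Polynomial.coe_add, Polynomial.coe_mul]
  simp [scalePoly, wt]
  ring

lemma scalePoly_polyF₂ : (scalePoly (polyF₂ K) : PowerSeries (MvPolynomial Idx K))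
    = PowerSeries.X ^ 3 * PowerSeries.C (polyF₂ K) := by
  simp only [polyF₂, Fin.sum_univ_three, map_add, map_mul, Polynomial.coe_add, Polynomial.coe_mul]
  simp [scalePoly, wt]
  ring

variable {𝕜 : Type*} [RCLike 𝕜]

lemma polyFun_polyF₁ : polyFun (polyF₁ 𝕜) = F₁ := by
  ext X
  simp [polyFun, polyF₁, F₁, dotProduct, coords]

lemma polyFun_polyF₂ : polyFun (polyF₂ 𝕜) = F₂ := by
  ext X
  simp [polyFun, polyF₂, F₂, dotProduct, coords]

lemma polyFun_polyH (B : Matrix (Fin 3) (Fin 3) 𝕜) (c : Fin 3 → 𝕜) (X : Phase 𝕜) :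
    polyFun (polyH B c) X = 1 / 2 * (X.1 ⬝ᵥ (B *ᵥ X.1)) + c ⬝ᵥ X.2 := by
  simp [polyFun, polyH, dotProduct, Matrix.mulVec, coords, Fin.sum_univ_three]
  ring

/-- The gradients of `½ M · B M + c · Γ`, `F₁` and `F₂` are generically independent. -/
lemma exists_minor_gradients_ne_zero [CharZero K] (B : Matrix (Fin 3) (Fin 3) K) (hB : Bᵀ = B)
    (hdet : IsUnit B.det) (c : Fin 3 → K) :
    ∃ τ : Fin 3 → Idx, (Matrix.of fun i j : Fin 3 => ![MvPolynomial.pderiv (τ j) (polyH B c),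
      MvPolynomial.pderiv (τ j) (polyF₁ K), MvPolynomial.pderiv (τ j) (polyF₂ K)] i).det ≠ 0 := by
  -- At the point with `B M = e₀` and `Γ = e₁`, the minor in the columns `M₀, M₁, Γ₁` equals `-2`,
  -- whatever `c` is.
  refine ⟨![Sum.inl 0, Sum.inl 1, Sum.inr 1], fun h => ?_⟩
  have h1 := congrArg (MvPolynomial.eval (Sum.elim (B⁻¹ *ᵥ Pi.single 0 1) (Pi.single 1 1))) h
  rw [map_zero, Matrix.det_fin_three] at h1
  have hBB : ∀ i, ∑ j, B i j * (B⁻¹ *ᵥ Pi.single 0 1) j = (Pi.single 0 1 : Fin 3 → K) i := by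
    intro i
    change (B *ᵥ (B⁻¹ *ᵥ Pi.single 0 1)) i = _
    rw [Matrix.mulVec_mulVec, Matrix.mul_nonsing_inv _ hdet, Matrix.one_mulVec]
  simp only [Matrix.of_apply, Matrix.cons_val, pderiv_polyH B hB, pderiv_polyF₁, pderiv_polyF₂,
    Sum.elim_inl, Sum.elim_inr, map_add, map_sub, map_mul, map_sum, MvPolynomial.eval_C,
    MvPolynomial.eval_X, hBB, map_zero] at h1
  simp at h1

end Polynomials

/-! ### The leading term of an expansion -/

section Leading

open Asymptotics Filter

variable {𝕜 : Type*} [RCLike 𝕜]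

lemma polynomial_leading_coeff {g : Polynomial 𝕜} {k : 𝕜 → 𝕜} (hk : ContinuousAt k 0)
    (h : (fun ε : 𝕜 => g.eval ε - ε ^ 2 * k ε) =O[𝓝 0] fun ε => ‖ε‖ ^ 3) :
    Polynomial.X ^ 2 ∣ g ∧ g.coeff 2 = k 0 := by
  have hO : (fun ε : 𝕜 => g.eval ε) =O[𝓝 0] fun ε => ‖ε‖ ^ 2 := by
    have h1 : (fun ε : 𝕜 => ‖ε‖ ^ 3) =O[𝓝 0] fun ε => ‖ε‖ ^ 2 := by
      refine IsBigO.of_bound 1 ?_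
      filter_upwards [Metric.ball_mem_nhds (0 : 𝕜) one_pos] with ε hε
      have hε1 : ‖ε‖ ≤ 1 := by simpa using (mem_ball_zero_iff.1 hε).le
      simp only [norm_pow, norm_norm, one_mul]
      exact pow_le_pow_of_le_one (norm_nonneg _) hε1 (by norm_num)
    have h2 : (fun ε : 𝕜 => ε ^ 2) =O[𝓝 0] fun ε => ‖ε‖ ^ 2 :=
      IsBigO.of_bound 1 (Eventually.of_forall fun ε => by simp)
    have h3 := h2.mul (hk.isBigO_one ℝ)
    simp only [mul_one] at h3
    simpa using (h.trans h1).add h3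
  obtain ⟨g', hg'⟩ := X_pow_dvd_of_isBigO g 2 hO
  refine ⟨⟨g', hg'⟩, ?_⟩
  have h1 : (fun ε : 𝕜 => g'.eval ε - k ε) =O[𝓝[≠] 0] fun ε => ‖ε‖ := by
    obtain ⟨C, hC⟩ := (h.mono (nhdsWithin_le_nhds (s := {0}ᶜ))).bound
    refine IsBigO.of_bound C ?_
    filter_upwards [hC, self_mem_nhdsWithin] with ε hε hne
    have hpos : 0 < ‖ε‖ ^ 2 := pow_pos (norm_pos_iff.2 hne) _
    rw [hg', Polynomial.eval_mul, Polynomial.eval_pow, Polynomial.eval_X, ← mul_sub, norm_mul,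
      norm_pow, norm_pow, norm_norm] at hε
    rw [norm_norm]
    refine le_of_mul_le_mul_left ?_ hpos
    calc _ ≤ _ := hε
      _ = _ := by ring
  have h2 : Tendsto (fun ε : 𝕜 => ‖ε‖) (𝓝[≠] 0) (𝓝 0) := by
    simpa using (continuous_norm.tendsto (0 : 𝕜)).mono_left nhdsWithin_le_nhds
  have h4 : Tendsto (fun ε : 𝕜 => g'.eval ε - k ε) (𝓝[≠] 0) (𝓝 (g'.eval 0 - k 0)) :=
    ((g'.continuous.tendsto 0).sub hk.tendsto).mono_left nhdsWithin_le_nhds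
  have h5 := sub_eq_zero.1 (tendsto_nhds_unique h4 (h1.trans_tendsto h2))
  rw [hg', mul_comm, Polynomial.coeff_mul_X_pow', if_pos le_rfl, ← h5,
    ← Polynomial.coeff_zero_eq_eval_zero]

/-- The leading term of an expansion is read off along the dilations. -/
lemma HasExpansion.exists_eq_X_sq_mul {f : Phase 𝕜 → 𝕜} {φ : PowerSeries (MvPolynomial Idx 𝕜)}
    (hf : HasExpansion f φ) (p : MvPolynomial Idx 𝕜) (k : Phase 𝕜 → 𝕜 → 𝕜)
    (hk : ∀ X, ContinuousAt (k X) 0) (hk0 : ∀ X, k X 0 = polyFun p X)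
    (h : ∀ X ε, f (dilate ε X) = ε ^ 2 * k X ε) :
    ∃ φ', φ = PowerSeries.X ^ 2 * φ' ∧ PowerSeries.constantCoeff φ' = p := by
  -- Accuracy `3` is the least that fixes the coefficients up to `ε²`.
  obtain ⟨q, hq1, hq2⟩ := hf 3
  have key : ∀ X : Phase 𝕜,
      Polynomial.X ^ 2 ∣ (scalePoly q).map (MvPolynomial.eval (coords X)) ∧
        ((scalePoly q).map (MvPolynomial.eval (coords X))).coeff 2 = polyFun p X := by
    intro X
    rw [← hk0]
    refine polynomial_leading_coeff (hk X) ?_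
    refine (isBigO_dilate hq2 X).neg_left.congr_left fun ε => ?_
    rw [h, polyFun_dilate, neg_sub]
  have hlow : ∀ n < 3, PowerSeries.coeff n φ = (scalePoly q).coeff n := fun n hn => by
    have := PowerSeries.X_pow_dvd_iff.1 hq1 n hn
    rwa [map_sub, sub_eq_zero, Polynomial.coeff_coe] at this
  have hdvd : PowerSeries.X ^ 2 ∣ φ := by
    rw [PowerSeries.X_pow_dvd_iff]
    intro n hn
    rw [hlow n (by omega)]
    apply MvPolynomial.funext
    intro v
    obtain ⟨X, rfl⟩ := coords_surjective v
    simpa using Polynomial.X_pow_dvd_iff.1 (key X).1 n hn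
  obtain ⟨φ', rfl⟩ := hdvd
  refine ⟨φ', rfl, ?_⟩
  have h2 := hlow 2 (by norm_num)
  rw [PowerSeries.coeff_X_pow_mul', if_pos le_rfl, Nat.sub_self,
    PowerSeries.coeff_zero_eq_constantCoeff_apply] at h2
  rw [h2]
  apply MvPolynomial.funext
  intro v
  obtain ⟨X, rfl⟩ := coords_surjective v
  simpa [polyFun] using (key X).2

end Leading

/-! ### Hamiltonians and fields of the two tops -/

namespace Body

variable {𝕜 : Type*} [RCLike 𝕜] (b : Body)

lemma isUnit_det_inertiaK : IsUnit (b.inertiaK 𝕜).det := by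
  have h : (b.inertiaK 𝕜).det = ((b.inertia.det : ℝ) : 𝕜) :=
    (RingHom.map_det (algebraMap ℝ 𝕜) b.inertia).symm
  rw [h, isUnit_iff_ne_zero]
  exact_mod_cast b.inertia_posDef.det_pos.ne'

lemma transpose_inertiaK : (b.inertiaK 𝕜)ᵀ = b.inertiaK 𝕜 := by
  ext i j
  have := congrFun (congrFun b.inertia_posDef.isHermitian i) j
  simp only [Matrix.conjTranspose_apply, star_trivial] at this
  simp [inertiaK, this]

lemma transpose_inv_inertiaK : (b.inertiaK 𝕜)⁻¹ᵀ = (b.inertiaK 𝕜)⁻¹ := by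
  rw [Matrix.transpose_nonsing_inv, transpose_inertiaK]

variable (𝕜) in
/-- The polynomial Hamiltonian of the heavy top. -/
def heavyPoly : MvPolynomial Idx 𝕜 :=
  polyH (b.inertiaK 𝕜)⁻¹ (((b.mass : 𝕜) * (b.grav : 𝕜)) • b.LK 𝕜)

lemma polyFun_heavyPoly : polyFun (b.heavyPoly 𝕜) = b.heavyH := by
  ext X
  rw [heavyPoly, polyFun_polyH, heavyH, smul_dotProduct, smul_eq_mul, dotProduct_comm (b.LK 𝕜)]

variable (𝕜) in
/-- The components of the heavy top's vector field as polynomials. -/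
def heavyVec : Idx → MvPolynomial Idx 𝕜 :=
  hamVec (fun j => MvPolynomial.X (Sum.inl j)) (fun j => MvPolynomial.X (Sum.inr j))
    (fun j => MvPolynomial.pderiv (Sum.inl j) (b.heavyPoly 𝕜))
    (fun j => MvPolynomial.pderiv (Sum.inr j) (b.heavyPoly 𝕜))

/-- The Euler–Poisson field is the Hamiltonian field of `H₂`, because `∂H₂/∂M = I⁻¹ M`, `∂H₂/∂Γ = m
g L` and `Γ × L = -L × Γ`. -/
lemma coords_heavyField (X : Phase 𝕜) (i : Idx) :
    coords (b.heavyField X) i = polyFun (b.heavyVec 𝕜 i) X := by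
  rw [polyFun, heavyVec, map_hamVec]
  simp only [heavyPoly, pderiv_polyH _ b.transpose_inv_inertiaK, Sum.elim_inl, Sum.elim_inr,
    map_sum, map_mul, MvPolynomial.eval_C, MvPolynomial.eval_X]
  have h1 : (fun j => ∑ k, (b.inertiaK 𝕜)⁻¹ j k * coords X (Sum.inl k))
      = (b.inertiaK 𝕜)⁻¹ *ᵥ X.1 := rfl
  rw [h1]
  rcases i with i | i
  · change (X.1 ⨯₃ ((b.inertiaK 𝕜)⁻¹ *ᵥ X.1)
      - ((b.mass : 𝕜) * (b.grav : 𝕜)) • (b.LK 𝕜 ⨯₃ X.2)) i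
      = (X.1 ⨯₃ ((b.inertiaK 𝕜)⁻¹ *ᵥ X.1)
        + X.2 ⨯₃ (((b.mass : 𝕜) * (b.grav : 𝕜)) • b.LK 𝕜)) i
    rw [map_smul, ← cross_anticomm X.2, smul_neg, sub_neg_eq_add]
  · rfl

variable (𝕜) in
/-- The vector `L × Γ` with polynomial entries. -/
def polyLΓ : Fin 3 → MvPolynomial Idx 𝕜 :=
  (fun i => (MvPolynomial.C (b.LK 𝕜 i) : MvPolynomial Idx 𝕜)) ⨯₃ fun i => MvPolynomial.X (Sum.inr i)

variable (𝕜) in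
/-- The matrix `J` with polynomial entries. -/
def polyJ : Matrix (Fin 3) (Fin 3) (MvPolynomial Idx 𝕜) :=
  Matrix.of fun i j => MvPolynomial.C (b.inertiaK 𝕜 i j)
    + MvPolynomial.C (b.mass : 𝕜) * (b.polyLΓ 𝕜 i * b.polyLΓ 𝕜 j)

lemma mapMatrix_polyJ (X : Phase 𝕜) :
    (MvPolynomial.eval (coords X)).mapMatrix (b.polyJ 𝕜) = b.J X.2 := by
  have h : ∀ i, MvPolynomial.eval (coords X) (b.polyLΓ 𝕜 i) = (b.LK 𝕜 ⨯₃ X.2) i := by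
    intro i
    fin_cases i <;> simp [polyLΓ, cross_apply, coords]
  ext i j
  simp only [RingHom.mapMatrix_apply, Matrix.map_apply, polyJ, Matrix.of_apply, map_add, map_mul,
    MvPolynomial.eval_C, h, J, Matrix.add_apply, Matrix.smul_apply, Matrix.vecMulVec_apply,
    smul_eq_mul]

/-- Cramer's rule, which shows that the inverse is analytic near the origin. Where `J` is singular
both sides are zero by convention. -/
lemma inv_J_apply (X : Phase 𝕜) (i j : Fin 3) :
    (b.J X.2)⁻¹ i j = polyFun ((b.polyJ 𝕜).adjugate i j) X / polyFun (b.polyJ 𝕜).det X := by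
  have h1 : polyFun (b.polyJ 𝕜).det X = (b.J X.2).det := by
    rw [polyFun, RingHom.map_det, mapMatrix_polyJ]
  have h2 : polyFun ((b.polyJ 𝕜).adjugate i j) X = (b.J X.2).adjugate i j := by
    rw [← mapMatrix_polyJ, ← RingHom.map_adjugate]
    rfl
  rw [h1, h2, Matrix.inv_def, Ring.inverse_eq_inv', Matrix.smul_apply, smul_eq_mul, div_eq_inv_mul]

lemma J_zero : b.J (0 : Fin 3 → 𝕜) = b.inertiaK 𝕜 := by
  simp [J]

lemma analyticAt_inv_J (i j : Fin 3) :
    AnalyticAt 𝕜 (fun X : Phase 𝕜 => (b.J X.2)⁻¹ i j) 0 := by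
  simp only [inv_J_apply]
  refine (analyticAt_polyFun _ _).div (analyticAt_polyFun _ _) ?_
  rw [polyFun, RingHom.map_det, mapMatrix_polyJ, Prod.snd_zero, J_zero]
  exact b.isUnit_det_inertiaK.ne_zero

lemma analyticAt_slidingH : AnalyticAt 𝕜 (b.slidingH (𝕜 := 𝕜)) 0 := by
  have hM : ∀ i, AnalyticAt 𝕜 (fun X : Phase 𝕜 => X.1 i) 0 := fun i =>
    (coordCLM 𝕜 (Sum.inl i)).analyticAt 0
  have hΓ : ∀ i, AnalyticAt 𝕜 (fun X : Phase 𝕜 => X.2 i) 0 := fun i =>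
    (coordCLM 𝕜 (Sum.inr i)).analyticAt 0
  have hJ := fun i j => b.analyticAt_inv_J (𝕜 := 𝕜) i j
  have hΩ : ∀ i, AnalyticAt 𝕜 (fun X : Phase 𝕜 => b.slidingΩ X i) 0 := fun i => by
    simp only [slidingΩ, Matrix.mulVec, dotProduct, Fin.sum_univ_three]
    exact (((hJ i 0).mul (hM 0)).add ((hJ i 1).mul (hM 1))).add ((hJ i 2).mul (hM 2))
  unfold slidingH
  simp only [Matrix.mulVec, dotProduct, Fin.sum_univ_three, cross_apply, Matrix.cons_val]
  have h0 := hΩ 0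
  have h1 := hΩ 1
  have h2 := hΩ 2
  have g0 := hΓ 0
  have g1 := hΓ 1
  have g2 := hΓ 2
  fun_prop

/-- `Ω` is linear in `M` and gains one factor `ε`. The squared translational term carries `ε⁶` and
is lost at `ε = 0`, where `J = I` turns `½ Ω · I Ω` into `½ M · I⁻¹ M`. -/
lemma exists_slidingH_dilate (X : Phase 𝕜) : ∃ k : 𝕜 → 𝕜, ContinuousAt k 0 ∧
    k 0 = polyFun (b.heavyPoly 𝕜) X ∧ ∀ ε, b.slidingH (dilate ε X) = ε ^ 2 * k ε := by
  let Ω : 𝕜 → Fin 3 → 𝕜 := fun ε => (b.J (ε ^ 2 • X.2))⁻¹ *ᵥ X.1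
  have hΩ : ∀ i, ContinuousAt (fun ε => Ω ε i) 0 := by
    intro i
    have hJ : ∀ j, ContinuousAt (fun ε : 𝕜 => (b.J (ε ^ 2 • X.2))⁻¹ i j) 0 := fun j =>
      ContinuousAt.comp_of_eq (f := fun ε : 𝕜 => dilate ε X)
        (g := fun X : Phase 𝕜 => (b.J X.2)⁻¹ i j) (b.analyticAt_inv_J i j).continuousAt
        (by simpa [ContinuousAt, dilate] using! tendsto_dilate X) (by simp [dilate])
    simp only [Ω, Matrix.mulVec, dotProduct, Fin.sum_univ_three]
    exact (((hJ 0).mul continuousAt_const).add ((hJ 1).mul continuousAt_const)).add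
      ((hJ 2).mul continuousAt_const)
  refine ⟨fun ε => 1 / 2 * (Ω ε ⬝ᵥ (b.inertiaK 𝕜 *ᵥ Ω ε))
    + 1 / 2 * (b.mass : 𝕜) * (ε ^ 2 * (X.2 ⬝ᵥ (Ω ε ⨯₃ b.LK 𝕜))) ^ 2
    + (b.mass : 𝕜) * (b.grav : 𝕜) * (X.2 ⬝ᵥ b.LK 𝕜), ?_, ?_, fun ε => ?_⟩
  · simp only [Matrix.mulVec, dotProduct, Fin.sum_univ_three, cross_apply, Matrix.cons_val]
    have h0 := hΩ 0
    have h1 := hΩ 1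
    have h2 := hΩ 2
    fun_prop
  · have h0 : Ω 0 = (b.inertiaK 𝕜)⁻¹ *ᵥ X.1 := by simp [Ω, J_zero]
    beta_reduce
    rw [polyFun_heavyPoly, heavyH, h0, Matrix.mulVec_mulVec,
      Matrix.mul_nonsing_inv _ b.isUnit_det_inertiaK, Matrix.one_mulVec, dotProduct_comm X.1]
    ring
  · have h1 : b.slidingΩ (dilate ε X) = ε • Ω ε := by
      simp only [slidingΩ, dilate, Ω, Matrix.mulVec_smul]
    rw [slidingH, h1]
    simp only [dilate, Matrix.mulVec_smul, smul_dotProduct, dotProduct_smul, smul_eq_mul,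
      map_smul, LinearMap.smul_apply]
    ring

end Body

/-! ### Meromorphic integrals with denominators cleared -/

section Quotient

open Filter

variable {𝕜 : Type*} [RCLike 𝕜]

lemma analyticAt_of_eventuallyEq_div {F P Q : Phase 𝕜 → 𝕜} {y : Phase 𝕜} (hP : AnalyticAt 𝕜 P y)
    (hQ : AnalyticAt 𝕜 Q y) (hy : Q y ≠ 0) (hF : ∀ᶠ z in 𝓝 y, F z = P z / Q z) :
    AnalyticAt 𝕜 F y :=
  (hP.div hQ hy).congr (hF.mono fun _ h => h.symm)

lemma sq_mul_partialDeriv_div {F P Q : Phase 𝕜 → 𝕜} {y : Phase 𝕜} (hP : AnalyticAt 𝕜 P y)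
    (hQ : AnalyticAt 𝕜 Q y) (hy : Q y ≠ 0) (hF : ∀ᶠ z in 𝓝 y, F z = P z / Q z) (i : Idx) :
    Q y ^ 2 * partialDeriv i F y = Q y * partialDeriv i P y - P y * partialDeriv i Q y := by
  have hFa := analyticAt_of_eventuallyEq_div hP hQ hy hF
  have h1 : P =ᶠ[𝓝 y] F * Q := by
    filter_upwards [hF, hQ.continuousAt.eventually_ne hy] with z hz hz0
    rw [Pi.mul_apply, hz, div_mul_cancel₀ _ hz0]
  have h2 : partialDeriv i P y = F y * partialDeriv i Q y + Q y * partialDeriv i F y := by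
    rw [partialDeriv, h1.fderiv_eq, fderiv_mul hFa.differentiableAt hQ.differentiableAt]
    rfl
  have h3 : P y = F y * Q y := h1.eq_of_nhds
  rw [h2, h3]
  ring

lemma sq_mul_fderiv_div_apply {F P Q : Phase 𝕜 → 𝕜} {y : Phase 𝕜} (hP : AnalyticAt 𝕜 P y)
    (hQ : AnalyticAt 𝕜 Q y) (hy : Q y ≠ 0) (hF : ∀ᶠ z in 𝓝 y, F z = P z / Q z) (V : Phase 𝕜) :
    Q y ^ 2 * fderiv 𝕜 F y V
      = ∑ i, coords V i * (Q y * partialDeriv i P y - P y * partialDeriv i Q y) := by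
  rw [fderiv_apply_eq_sum, Finset.mul_sum]
  refine Finset.sum_congr rfl fun i _ => ?_
  rw [← sq_mul_partialDeriv_div hP hQ hy hF]
  ring

/-- The equation of a meromorphic first integral, cleared of denominators. -/
lemma eventually_first_integral_eq_zero {V : Phase 𝕜 → Phase 𝕜} {F P Q : Phase 𝕜 → 𝕜}
    {D : Set (Phase 𝕜)} {x : Phase 𝕜} (hD : D ∈ 𝓝 x) (hF : IsFirstIntegralOn V F D)
    (hP : AnalyticAt 𝕜 P x) (hQ : AnalyticAt 𝕜 Q x)
    (hPQ : ∀ᶠ y in 𝓝 x, Q y ≠ 0 → F y = P y / Q y) :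
    ∀ᶠ y in 𝓝 x, Q y *
      ∑ i, coords (V y) i * (Q y * partialDeriv i P y - P y * partialDeriv i Q y) = 0 := by
  filter_upwards [hD, hP.eventually_analyticAt, hQ.eventually_analyticAt,
    hPQ.eventually_nhds] with y hyD hyP hyQ hy
  -- The extra factor `Q y` makes the equation true at zeros of `Q` as well, where nothing is known
  -- about `F`.
  by_cases h0 : Q y = 0
  · rw [h0, zero_mul]
  · have hFy : ∀ᶠ z in 𝓝 y, F z = P z / Q z := by
      filter_upwards [hy, hyQ.continuousAt.eventually_ne h0] with z hz hz0 using hz hz0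
    rw [← sq_mul_fderiv_div_apply hyP hyQ h0 hFy,
      hF y hyD (analyticAt_of_eventuallyEq_div hyP hyQ h0 hFy), mul_zero, mul_zero]

end Quotient

/-! ### Functional independence through minors -/

section Independence

open Filter

variable {𝕜 : Type*} [RCLike 𝕜]

variable (𝕜) in
/-- The components of a covector. -/
def components : (Phase 𝕜 →L[𝕜] 𝕜) →ₗ[𝕜] (Idx → 𝕜) where
  toFun f i := f (basisVec 𝕜 i)
  map_add' _ _ := rfl
  map_smul' _ _ := rfl

lemma components_injective : Function.Injective (components 𝕜) := by
  intro f g h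
  refine ContinuousLinearMap.ext fun X => ?_
  rw [← sum_coords_smul_basisVec X, map_sum, map_sum]
  refine Finset.sum_congr rfl fun i _ => ?_
  rw [map_smul, map_smul]
  exact congrArg _ (congrFun h i)

lemma linearIndependent_fderiv_iff {n : ℕ} (f : Fin n → Phase 𝕜 → 𝕜) (y : Phase 𝕜) :
    LinearIndependent 𝕜 (fun i => fderiv 𝕜 (f i) y)
      ↔ LinearIndependent 𝕜 fun i (j : Idx) => partialDeriv j (f i) y :=
  ((components 𝕜).linearIndependent_iff (LinearMap.ker_eq_bot.2 components_injective)).symm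

/-- The minors of the Jacobian matrix of `f₁, f₂, f₃` and a quotient `P / Q`, the last row being
multiplied by `Q ^ 2`. -/
def quotientMinor (f₁ f₂ f₃ P Q : Phase 𝕜 → 𝕜) (σ : Fin 4 → Idx) (y : Phase 𝕜) : 𝕜 :=
  (Matrix.of fun i j : Fin 4 => ![partialDeriv (σ j) f₁, partialDeriv (σ j) f₂,
    partialDeriv (σ j) f₃,
    fun y => Q y * partialDeriv (σ j) P y - P y * partialDeriv (σ j) Q y] i y).det

lemma linearIndependent_fderiv_iff_quotientMinor {f₁ f₂ f₃ F P Q : Phase 𝕜 → 𝕜} {y : Phase 𝕜}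
    (hP : AnalyticAt 𝕜 P y) (hQ : AnalyticAt 𝕜 Q y) (hy : Q y ≠ 0)
    (hF : ∀ᶠ z in 𝓝 y, F z = P z / Q z) :
    LinearIndependent 𝕜 (fun i => fderiv 𝕜 (![f₁, f₂, f₃, F] i) y)
      ↔ ∃ σ, quotientMinor f₁ f₂ f₃ P Q σ y ≠ 0 := by
  have key : ∀ σ, quotientMinor f₁ f₂ f₃ P Q σ y
      = Q y ^ 2 * (Matrix.of fun i j : Fin 4 => partialDeriv (σ j) (![f₁, f₂, f₃, F] i) y).det := by
    intro σ
    have h : (Matrix.of fun i j : Fin 4 => ![partialDeriv (σ j) f₁, partialDeriv (σ j) f₂,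
        partialDeriv (σ j) f₃,
        fun y => Q y * partialDeriv (σ j) P y - P y * partialDeriv (σ j) Q y] i y)
        = Matrix.of fun i j => ![1, 1, 1, Q y ^ 2] i * (Matrix.of fun i j : Fin 4 =>
          partialDeriv (σ j) (![f₁, f₂, f₃, F] i) y) i j := by
      ext i j
      fin_cases i
      · simp
      · simp
      · simp
      · exact (sq_mul_partialDeriv_div hP hQ hy hF (σ j)).symm
    rw [quotientMinor, h, Matrix.det_mul_column]
    simp [Fin.prod_univ_four]
  rw [linearIndependent_fderiv_iff]
  constructor
  · intro h
    obtain ⟨τ, hτ⟩ := exists_minor_ne_zero _ h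
    exact ⟨τ, by rw [key]; exact mul_ne_zero (pow_ne_zero _ hy) hτ⟩
  · rintro ⟨σ, hσ⟩
    rw [key] at hσ
    exact linearIndependent_of_minor_ne_zero _ σ (right_ne_zero_of_mul hσ)

/-- A functionally independent quotient has a minor that does not vanish near a given point. -/
lemma exists_quotientMinor_not_eventually_zero {f₁ f₂ f₃ F P Q : Phase 𝕜 → 𝕜} {D : Set (Phase 𝕜)}
    {x : Phase 𝕜} (hD : D ∈ 𝓝 x) (hF : FunctionallyIndependentOn ![f₁, f₂, f₃, F] D)
    (hP : AnalyticAt 𝕜 P x) (hQ : AnalyticAt 𝕜 Q x) (hQ0 : ∃ᶠ y in 𝓝 x, Q y ≠ 0)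
    (hPQ : ∀ᶠ y in 𝓝 x, Q y ≠ 0 → F y = P y / Q y) :
    ∃ σ, ¬ ∀ᶠ y in 𝓝 x, quotientMinor f₁ f₂ f₃ P Q σ y = 0 := by
  by_contra! h
  have hE := ((eventually_all.2 h).and (hP.eventually_analyticAt.and
    (hQ.eventually_analyticAt.and hPQ))).eventually_nhds
  -- Independence holds only on a dense set and is visible in the minors only where `Q ≠ 0`. Hence
  -- two choices: `y₁` with `Q y₁ ≠ 0`, then an independent point `y₂` so close that `Q` is still
  -- nonzero.
  obtain ⟨y₁, hy₁, hy₁E, hy₁D⟩ := (hQ0.and_eventually (hE.and hD)).exists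
  have hy₁' := (hy₁E.and (hy₁E.self_of_nhds.2.2.1.continuousAt.eventually_ne hy₁)).eventually_nhds
  obtain ⟨y₂, ⟨-, -, hli⟩, hy₂⟩ := ((mem_closure_iff_frequently.1 (hF hy₁D)).and_eventually
    hy₁').exists
  obtain ⟨⟨hm, hPy, hQy, -⟩, hQ0⟩ := hy₂.self_of_nhds
  obtain ⟨σ, hσ⟩ := (linearIndependent_fderiv_iff_quotientMinor hPy hQy hQ0
    (hy₂.mono fun z hz => hz.1.2.2.2 hz.2)).1 hli
  exact hσ (hm σ)

lemma analyticAt_quotientMinor {f₁ f₂ f₃ P Q : Phase 𝕜 → 𝕜} {x : Phase 𝕜}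
    (h₁ : AnalyticAt 𝕜 f₁ x) (h₂ : AnalyticAt 𝕜 f₂ x) (h₃ : AnalyticAt 𝕜 f₃ x)
    (hP : AnalyticAt 𝕜 P x) (hQ : AnalyticAt 𝕜 Q x) (σ : Fin 4 → Idx) :
    AnalyticAt 𝕜 (quotientMinor f₁ f₂ f₃ P Q σ) x := by
  unfold quotientMinor
  simp only [Matrix.det_apply', Matrix.of_apply]
  refine Finset.analyticAt_fun_sum _ fun τ _ => analyticAt_const.mul
    (Finset.analyticAt_fun_prod _ fun i _ => ?_)
  generalize τ i = j
  fin_cases j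
  · exact analyticAt_partialDeriv h₁ _
  · exact analyticAt_partialDeriv h₂ _
  · exact analyticAt_partialDeriv h₃ _
  · exact (hQ.mul (analyticAt_partialDeriv hP _)).sub (hP.mul (analyticAt_partialDeriv hQ _))

end Independence

/-! ### Rational first integrals on the whole phase space -/

section RationalIntegral

open Filter

variable {𝕜 : Type*} [RCLike 𝕜]

/-- By the identity theorem a polynomial that vanishes near one point vanishes everywhere, and over
an infinite field it is then zero. -/
lemma dense_polyFun_ne_zero {q : MvPolynomial Idx 𝕜} (hq : q ≠ 0) :
    Dense {X : Phase 𝕜 | polyFun q X ≠ 0} := by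
  intro X
  rw [mem_closure_iff_frequently]
  intro h
  refine hq (MvPolynomial.funext fun v => ?_)
  obtain ⟨Y, rfl⟩ := coords_surjective v
  have h1 : polyFun q =ᶠ[𝓝 X] fun _ => 0 := h.mono fun Y hY => by simpa using hY
  have h2 := AnalyticOnNhd.eq_of_eventuallyEq (fun Y _ => analyticAt_polyFun q Y)
    (fun _ _ => analyticAt_const) h1
  simpa [polyFun] using congrFun h2 Y

/-- A rational first integral of a polynomial vector field gives integrability. -/
lemma isIntegrableOn_of_rational {V : Phase 𝕜 → Phase 𝕜} {v : Idx → MvPolynomial Idx 𝕜}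
    (hV : ∀ X i, coords (V X) i = polyFun (v i) X) {h a b : MvPolynomial Idx 𝕜} (hb : b ≠ 0)
    (hint : ∑ i, v i * (b * MvPolynomial.pderiv i a - a * MvPolynomial.pderiv i b) = 0)
    (hind : ∃ τ : Fin 4 → Idx, (Matrix.of fun i j : Fin 4 =>
        ![MvPolynomial.pderiv (τ j) h, MvPolynomial.pderiv (τ j) (polyF₁ 𝕜),
          MvPolynomial.pderiv (τ j) (polyF₂ 𝕜),
          b * MvPolynomial.pderiv (τ j) a - a * MvPolynomial.pderiv (τ j) b] i).det ≠ 0) :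
    IsIntegrableOn V (polyFun h) Set.univ := by
  have hda := fun i => partialDeriv_polyFun a i
  have hdb := fun i => partialDeriv_polyFun b i
  refine ⟨fun X => polyFun a X / polyFun b X, fun x _ => ⟨polyFun a, polyFun b,
    analyticAt_polyFun a x, analyticAt_polyFun b x,
    mem_closure_iff_frequently.1 (dense_polyFun_ne_zero hb x),
    Eventually.of_forall fun _ _ => rfl⟩, fun x _ hx => ?_, fun x _ => ?_⟩
  -- The quotient may be analytic at a zero of `b`, where its value is the default `0`. The
  -- derivative along `V` vanishes there by continuity from the dense set `b ≠ 0`.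
  · have hcont : ContinuousAt
        (fun X => fderiv 𝕜 (fun X => polyFun a X / polyFun b X) X (V X)) x := by
      simp only [fderiv_apply_eq_sum, hV]
      exact tendsto_finsetSum _ fun i _ => (analyticAt_polyFun (v i) x).continuousAt.mul
        (analyticAt_partialDeriv hx i).continuousAt
    by_contra hne
    refine mem_closure_iff_frequently.1 (dense_polyFun_ne_zero hb x) ?_
    filter_upwards [hcont.eventually_ne hne] with y hy
    refine not_not.2 ?_
    by_contra hby
    have h1 := sq_mul_fderiv_div_apply (analyticAt_polyFun a y) (analyticAt_polyFun b y) hby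
      (F := fun X => polyFun a X / polyFun b X) (Eventually.of_forall fun _ => rfl) (V y)
    have h2 := congrArg (fun q => polyFun q y) hint
    simp only [hV, hda, hdb] at h1
    simp only [polyFun, map_sum, map_mul, map_sub, map_zero] at h2
    replace h1 := h1.trans h2
    exact hy ((mul_eq_zero.1 h1).resolve_left (pow_ne_zero _ hby))
  · obtain ⟨τ, hτ⟩ := hind
    refine closure_mono ?_ (dense_polyFun_ne_zero (mul_ne_zero hb hτ) x)
    intro y hy
    rw [Set.mem_ofPred_eq, polyFun, map_mul] at hy
    have hby : polyFun b y ≠ 0 := left_ne_zero_of_mul hy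
    refine ⟨trivial, fun i => ?_, ?_⟩
    · rw [← polyFun_polyF₁, ← polyFun_polyF₂]
      fin_cases i
      · exact analyticAt_polyFun h y
      · exact analyticAt_polyFun _ y
      · exact analyticAt_polyFun _ y
      · exact (analyticAt_polyFun a y).div (analyticAt_polyFun b y) hby
    · rw [linearIndependent_fderiv_iff_quotientMinor (analyticAt_polyFun a y)
        (analyticAt_polyFun b y) hby (Eventually.of_forall fun _ => rfl)]
      refine ⟨τ, ?_⟩
      have hdet := right_ne_zero_of_mul hy
      rw [RingHom.map_det] at hdet
      rw [quotientMinor]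
      convert hdet using 3
      rw [← polyFun_polyF₁, ← polyFun_polyF₂]
      ext i j
      simp only [partialDeriv_polyFun]
      fin_cases i
      · rfl
      · rfl
      · rfl
      · simp [polyFun]

end RationalIntegral

/-! ### The formal equations satisfied by the integrals of the sliding top -/

section Descent

open Filter

variable {𝕜 : Type*} [RCLike 𝕜]

lemma coeffwise_X_pow_mul {K A : Type*} [CommRing K] [CommRing A] [Algebra K A]
    (δ : Derivation K A A) (n : ℕ) (φ : PowerSeries A) :
    coeffwise δ (PowerSeries.X ^ n * φ) = PowerSeries.X ^ n * coeffwise δ φ := by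
  ext m
  simp only [coeff_coeffwise, PowerSeries.coeff_X_pow_mul']
  split_ifs
  · rfl
  · exact map_zero δ

lemma coeffwise_C {K A : Type*} [CommRing K] [CommRing A] [Algebra K A]
    (δ : Derivation K A A) (a : A) : coeffwise δ (PowerSeries.C a) = PowerSeries.C (δ a) := by
  ext m
  simp only [coeff_coeffwise, PowerSeries.coeff_C]
  split_ifs
  · rfl
  · exact map_zero δ

/-- The Lie-Poisson Hamiltonian vector field of a power series. -/
def formalField {K : Type*} [Field K] (φ : PowerSeries (MvPolynomial Idx K)) :
    Idx → PowerSeries (MvPolynomial Idx K) :=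
  hamVec (fun j => PowerSeries.C (MvPolynomial.X (Sum.inl j)))
    (fun j => PowerSeries.C (MvPolynomial.X (Sum.inr j)))
    (fun j => coeffwise (MvPolynomial.pderiv (R := K) (Sum.inl j)) φ)
    (fun j => coeffwise (MvPolynomial.pderiv (R := K) (Sum.inr j)) φ)

lemma constantCoeff_coeffwise {K A : Type*} [CommRing K] [CommRing A] [Algebra K A]
    (δ : Derivation K A A) (φ : PowerSeries A) :
    PowerSeries.constantCoeff (coeffwise δ φ) = δ (PowerSeries.constantCoeff φ) := by
  rw [← PowerSeries.coeff_zero_eq_constantCoeff_apply, coeff_coeffwise,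
    PowerSeries.coeff_zero_eq_constantCoeff_apply]

section Formal

variable {K : Type*} [Field K] (φ : PowerSeries (MvPolynomial Idx K))

lemma sum_formalField_mul_self :
    ∑ i, formalField φ i * coeffwise (MvPolynomial.pderiv (R := K) i) φ = 0 := by
  rw [← sum_hamVec_mul_gradient (fun j => PowerSeries.C (MvPolynomial.X (R := K) (Sum.inl j)))
    (fun j => PowerSeries.C (MvPolynomial.X (Sum.inr j)))
    (fun j => coeffwise (MvPolynomial.pderiv (R := K) (Sum.inl j)) φ)
    (fun j => coeffwise (MvPolynomial.pderiv (R := K) (Sum.inr j)) φ)]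
  exact Finset.sum_congr rfl fun i _ => by cases i <;> rfl

lemma sum_formalField_mul_F₁ :
    ∑ i, formalField φ i * coeffwise (MvPolynomial.pderiv (R := K) i)
      (PowerSeries.C (polyF₁ K)) = 0 := by
  rw [← sum_hamVec_mul_F₁ (fun j => PowerSeries.C (MvPolynomial.X (R := K) (Sum.inl j)))
    (fun j => PowerSeries.C (MvPolynomial.X (Sum.inr j)))
    (fun j => coeffwise (MvPolynomial.pderiv (R := K) (Sum.inl j)) φ)
    (fun j => coeffwise (MvPolynomial.pderiv (R := K) (Sum.inr j)) φ)]
  refine Finset.sum_congr rfl fun i _ => ?_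
  rw [coeffwise_C, pderiv_polyF₁]
  cases i
  · simp only [Sum.elim_inl, map_zero, mul_zero]
  · simp only [Sum.elim_inr, map_mul, map_ofNat]
    rfl

lemma sum_formalField_mul_F₂ :
    ∑ i, formalField φ i * coeffwise (MvPolynomial.pderiv (R := K) i)
      (PowerSeries.C (polyF₂ K)) = 0 := by
  rw [← sum_hamVec_mul_F₂ (fun j => PowerSeries.C (MvPolynomial.X (R := K) (Sum.inl j)))
    (fun j => PowerSeries.C (MvPolynomial.X (Sum.inr j)))
    (fun j => coeffwise (MvPolynomial.pderiv (R := K) (Sum.inl j)) φ)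
    (fun j => coeffwise (MvPolynomial.pderiv (R := K) (Sum.inr j)) φ)]
  refine Finset.sum_congr rfl fun i _ => ?_
  rw [coeffwise_C, pderiv_polyF₂]
  cases i <;> rfl

end Formal

lemma HasExpansion.of_eq {f : Phase 𝕜 → 𝕜} {φ ψ : PowerSeries (MvPolynomial Idx 𝕜)}
    (h : HasExpansion f φ) (e : φ = ψ) : HasExpansion f ψ := e ▸ h

lemma hasExpansion_fst (j : Fin 3) : HasExpansion (fun X : Phase 𝕜 => X.1 j)
    (PowerSeries.X * PowerSeries.C (MvPolynomial.X (Sum.inl j))) := by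
  have h := hasExpansion_polyFun (𝕜 := 𝕜) (MvPolynomial.X (Sum.inl j))
  have h1 : polyFun (MvPolynomial.X (Sum.inl j)) = fun X : Phase 𝕜 => X.1 j := by
    ext X
    simp [polyFun, coords]
  rw [h1] at h
  convert h using 1
  simp only [scalePoly, wt, MvPolynomial.aeval_X, Sum.elim_inl, Polynomial.coe_mul,
    Polynomial.coe_C, Polynomial.coe_X, pow_one]
  exact mul_comm _ _

lemma hasExpansion_snd (j : Fin 3) : HasExpansion (fun X : Phase 𝕜 => X.2 j)
    (PowerSeries.X ^ 2 * PowerSeries.C (MvPolynomial.X (Sum.inr j))) := by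
  have h := hasExpansion_polyFun (𝕜 := 𝕜) (MvPolynomial.X (Sum.inr j))
  have h1 : polyFun (MvPolynomial.X (Sum.inr j)) = fun X : Phase 𝕜 => X.2 j := by
    ext X
    simp [polyFun, coords]
  rw [h1] at h
  convert h using 1
  simp only [scalePoly, wt, MvPolynomial.aeval_X, Sum.elim_inr, Polynomial.coe_mul,
    Polynomial.coe_C, Polynomial.coe_pow, Polynomial.coe_X]
  exact mul_comm _ _

/-- Expansion of the Hamiltonian vector field of a function that vanishes to second order. -/
lemma hasExpansion_hamiltonianField {H : Phase 𝕜 → 𝕜} (hH : AnalyticAt 𝕜 H 0)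
    {φ : PowerSeries (MvPolynomial Idx 𝕜)} (hφ : HasExpansion H (PowerSeries.X ^ 2 * φ))
    (i : Idx) : HasExpansion (fun X => coords (hamiltonianField H X) i)
      (PowerSeries.X ^ (wt i + 1) * formalField φ i) := by
  choose ψ hψ using fun i => exists_hasExpansion (analyticAt_partialDeriv hH i)
  have key := fun i => HasExpansion.partialDeriv hH hφ (hψ i)
  have hX : (PowerSeries.X : PowerSeries (MvPolynomial Idx 𝕜)) ≠ 0 := PowerSeries.X_ne_zero
  -- As `H` starts at order two, `∂H/∂M` carries a factor `X` and `∂H/∂Γ` none. So `M × ∂H/∂M` and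
  -- `Γ × ∂H/∂Γ` both carry `X²`, and `Γ × ∂H/∂M` carries `X³`: always `wt i + 1`.
  have hM : ∀ j, ψ (Sum.inl j)
      = PowerSeries.X * coeffwise (MvPolynomial.pderiv (R := 𝕜) (Sum.inl j)) φ := fun j => by
    have h := key (Sum.inl j)
    rw [coeffwise_X_pow_mul] at h
    refine mul_left_cancel₀ hX ?_
    rw [← mul_assoc, ← sq, h]
    simp [wt]
  have hΓ : ∀ j, ψ (Sum.inr j)
      = coeffwise (MvPolynomial.pderiv (R := 𝕜) (Sum.inr j)) φ := fun j => by
    have h := key (Sum.inr j)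
    rw [coeffwise_X_pow_mul] at h
    exact (mul_left_cancel₀ (pow_ne_zero 2 hX) h).symm
  have hm := fun j => hM j ▸ hψ (Sum.inl j)
  have hg := fun j => hΓ j ▸ hψ (Sum.inr j)
  have cM := hasExpansion_fst (𝕜 := 𝕜)
  have cΓ := hasExpansion_snd (𝕜 := 𝕜)
  simp only [coords_hamiltonianField]
  have hl : ∀ p q r s : Fin 3, HasExpansion (fun X : Phase 𝕜 =>
      X.1 p * partialDeriv (Sum.inl q) H X - X.1 r * partialDeriv (Sum.inl s) H X
        + (X.2 p * partialDeriv (Sum.inr q) H X - X.2 r * partialDeriv (Sum.inr s) H X)) _ :=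
    fun p q r s => (((cM p).mul (hm q)).sub ((cM r).mul (hm s))).add
      (((cΓ p).mul (hg q)).sub ((cΓ r).mul (hg s)))
  have hr : ∀ p q r s : Fin 3, HasExpansion (fun X : Phase 𝕜 =>
      X.2 p * partialDeriv (Sum.inl q) H X - X.2 r * partialDeriv (Sum.inl s) H X) _ :=
    fun p q r s => ((cΓ p).mul (hm q)).sub ((cΓ r).mul (hm s))
  rcases i with i | i
  · fin_cases i
    · refine (hl 1 2 2 1).of_eq
        (ψ := PowerSeries.X ^ (1 + 1) * formalField φ (Sum.inl 0)) ?_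
      simp only [formalField, hamVec, Sum.elim_inl, Pi.add_apply, cross_apply, Matrix.cons_val]
      ring
    · refine (hl 2 0 0 2).of_eq
        (ψ := PowerSeries.X ^ (1 + 1) * formalField φ (Sum.inl 1)) ?_
      simp only [formalField, hamVec, Sum.elim_inl, Pi.add_apply, cross_apply, Matrix.cons_val]
      ring
    · refine (hl 0 1 1 0).of_eq
        (ψ := PowerSeries.X ^ (1 + 1) * formalField φ (Sum.inl 2)) ?_
      simp only [formalField, hamVec, Sum.elim_inl, Pi.add_apply, cross_apply, Matrix.cons_val]
      ring
  · fin_cases i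
    · refine (hr 1 2 2 1).of_eq
        (ψ := PowerSeries.X ^ (2 + 1) * formalField φ (Sum.inr 0)) ?_
      simp only [formalField, hamVec, Sum.elim_inr, cross_apply, Matrix.cons_val]
      ring
    · refine (hr 2 0 0 2).of_eq
        (ψ := PowerSeries.X ^ (2 + 1) * formalField φ (Sum.inr 1)) ?_
      simp only [formalField, hamVec, Sum.elim_inr, cross_apply, Matrix.cons_val]
      ring
    · refine (hr 0 1 1 0).of_eq
        (ψ := PowerSeries.X ^ (2 + 1) * formalField φ (Sum.inr 2)) ?_
      simp only [formalField, hamVec, Sum.elim_inr, cross_apply, Matrix.cons_val]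
      ring

lemma HasExpansion.ne_zero_of_not_eventually {f : Phase 𝕜 → 𝕜} (hf : AnalyticAt 𝕜 f 0)
    (h0 : ¬ ∀ᶠ X in 𝓝 0, f X = 0) {φ : PowerSeries (MvPolynomial Idx 𝕜)} (h : HasExpansion f φ) :
    φ ≠ 0 := by
  rintro rfl
  exact h0 (eventuallyEq_zero_of_hasExpansion_zero hf h)

/-- The formal counterpart of the equation of a first integral. -/
lemma sum_formalField_mul_quotient_eq_zero {H P Q : Phase 𝕜 → 𝕜} (hH : AnalyticAt 𝕜 H 0)
    (hP : AnalyticAt 𝕜 P 0) (hQ : AnalyticAt 𝕜 Q 0) {φ π κ : PowerSeries (MvPolynomial Idx 𝕜)}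
    (hφ : HasExpansion H (PowerSeries.X ^ 2 * φ)) (hπ : HasExpansion P π) (hκ : HasExpansion Q κ)
    (hκ0 : κ ≠ 0)
    (h : ∀ᶠ y in 𝓝 0, Q y * ∑ i, coords (hamiltonianField H y) i
      * (Q y * partialDeriv i P y - P y * partialDeriv i Q y) = 0) :
    ∑ i, formalField φ i * (κ * coeffwise (MvPolynomial.pderiv (R := 𝕜) i) π
      - π * coeffwise (MvPolynomial.pderiv (R := 𝕜) i) κ) = 0 := by
  choose ψ hψ using fun i => exists_hasExpansion (analyticAt_partialDeriv hP i)
  choose χ hχ using fun i => exists_hasExpansion (analyticAt_partialDeriv hQ i)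
  have h1 := (hκ.mul (HasExpansion.sum Finset.univ fun i =>
    (hasExpansion_hamiltonianField hH hφ i).mul
      ((hκ.mul (hψ i)).sub (hπ.mul (hχ i))))).congr (g := fun _ => 0) h
  have h2 := h1.unique (hasExpansion_const 0)
  rw [map_zero, map_zero] at h2
  -- The factor `X ^ wt i` of the field is absorbed by the partial derivatives in direction `i`; one
  -- common factor `X` remains and is cancelled.
  refine (mul_eq_zero.1 ((mul_eq_zero.1 h2).resolve_left hκ0 ▸ ?_ :
    PowerSeries.X * _ = (0 : PowerSeries (MvPolynomial Idx 𝕜)))).resolve_left PowerSeries.X_ne_zero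
  rw [Finset.mul_sum]
  refine Finset.sum_congr rfl fun i _ => ?_
  rw [HasExpansion.partialDeriv hP hπ (hψ i), HasExpansion.partialDeriv hQ hκ (hχ i), pow_succ]
  ring

/-- The formal minor of an independent quadruple does not vanish. -/
lemma formal_minor_ne_zero {f₁ f₂ f₃ P Q : Phase 𝕜 → 𝕜} (h₁ : AnalyticAt 𝕜 f₁ 0)
    (h₂ : AnalyticAt 𝕜 f₂ 0) (h₃ : AnalyticAt 𝕜 f₃ 0) (hP : AnalyticAt 𝕜 P 0)
    (hQ : AnalyticAt 𝕜 Q 0) {φ₁ φ₂ φ₃ π κ : PowerSeries (MvPolynomial Idx 𝕜)}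
    (e₁ : HasExpansion f₁ φ₁) (e₂ : HasExpansion f₂ φ₂) (e₃ : HasExpansion f₃ φ₃)
    (hπ : HasExpansion P π) (hκ : HasExpansion Q κ) {σ : Fin 4 → Idx}
    (hσ : ¬ ∀ᶠ y in 𝓝 0, quotientMinor f₁ f₂ f₃ P Q σ y = 0) :
    (Matrix.of fun i j : Fin 4 => ![coeffwise (MvPolynomial.pderiv (R := 𝕜) (σ j)) φ₁,
      coeffwise (MvPolynomial.pderiv (R := 𝕜) (σ j)) φ₂,
      coeffwise (MvPolynomial.pderiv (R := 𝕜) (σ j)) φ₃,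
      κ * coeffwise (MvPolynomial.pderiv (R := 𝕜) (σ j)) π
        - π * coeffwise (MvPolynomial.pderiv (R := 𝕜) (σ j)) κ] i).det ≠ 0 := by
  choose ψ₁ hψ₁ using fun i => exists_hasExpansion (analyticAt_partialDeriv h₁ i)
  choose ψ₂ hψ₂ using fun i => exists_hasExpansion (analyticAt_partialDeriv h₂ i)
  choose ψ₃ hψ₃ using fun i => exists_hasExpansion (analyticAt_partialDeriv h₃ i)
  choose ψ hψ using fun i => exists_hasExpansion (analyticAt_partialDeriv hP i)
  choose χ hχ using fun i => exists_hasExpansion (analyticAt_partialDeriv hQ i)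
  have hdet : HasExpansion (quotientMinor f₁ f₂ f₃ P Q σ) (Matrix.of fun i j : Fin 4 =>
      ![ψ₁ (σ j), ψ₂ (σ j), ψ₃ (σ j), κ * ψ (σ j) - π * χ (σ j)] i).det := by
    refine HasExpansion.det fun i j => ?_
    fin_cases i
    · exact hψ₁ _
    · exact hψ₂ _
    · exact hψ₃ _
    · exact (hκ.mul (hψ _)).sub (hπ.mul (hχ _))
  have hne := hdet.ne_zero_of_not_eventually (analyticAt_quotientMinor h₁ h₂ h₃ hP hQ σ) hσ
  -- Coefficientwise differentiation multiplies column `j` by `X ^ wt (σ j)`, so the two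
  -- determinants differ by a power of `X`.
  have hM : (Matrix.of fun i j : Fin 4 => ![coeffwise (MvPolynomial.pderiv (R := 𝕜) (σ j)) φ₁,
      coeffwise (MvPolynomial.pderiv (R := 𝕜) (σ j)) φ₂,
      coeffwise (MvPolynomial.pderiv (R := 𝕜) (σ j)) φ₃,
      κ * coeffwise (MvPolynomial.pderiv (R := 𝕜) (σ j)) π
        - π * coeffwise (MvPolynomial.pderiv (R := 𝕜) (σ j)) κ] i)
      = Matrix.of fun i j => (PowerSeries.X ^ wt (σ j) : PowerSeries (MvPolynomial Idx 𝕜))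
        * (Matrix.of fun i j : Fin 4 =>
          ![ψ₁ (σ j), ψ₂ (σ j), ψ₃ (σ j), κ * ψ (σ j) - π * χ (σ j)] i) i j := by
    ext1 i j
    simp only [HasExpansion.partialDeriv h₁ e₁ (hψ₁ _), HasExpansion.partialDeriv h₂ e₂ (hψ₂ _),
      HasExpansion.partialDeriv h₃ e₃ (hψ₃ _), HasExpansion.partialDeriv hP hπ (hψ _),
      HasExpansion.partialDeriv hQ hκ (hχ _)]
    fin_cases i
    · rfl
    · rfl
    · rfl
    · simp only [Matrix.of_apply]
      change κ * (_ * _) - π * (_ * _) = _ * (κ * ψ (σ j) - π * χ (σ j))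
      ring
  rw [hM, Matrix.det_mul_row]
  exact mul_ne_zero (Finset.prod_ne_zero_iff.2 fun j _ => pow_ne_zero _ PowerSeries.X_ne_zero) hne

end Descent

end SlidingTop

end

/-! ### From the sliding top to the heavy top -/

theorem lemma1 {𝕜 : Type*} [RCLike 𝕜] (b : SlidingTop.Body)
    (D : Set (SlidingTop.Phase 𝕜)) (hD : IsOpen D) (h0 : (0 : SlidingTop.Phase 𝕜) ∈ D)
    (hDdom : D ⊆ b.slidingDomain 𝕜)
    (hint : SlidingTop.IsIntegrableOn b.slidingField b.slidingH D) :
    SlidingTop.IsIntegrableOn (𝕜 := 𝕜) b.heavyField b.heavyH Set.univ := by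
  open SlidingTop in
  obtain ⟨F, hF, hFint, hFind⟩ := hint
  obtain ⟨P, Q, hP, hQ, hQ0, hPQ⟩ := hF 0 h0
  have hD0 : D ∈ 𝓝 0 := hD.mem_nhds h0
  have hH := b.analyticAt_slidingH (𝕜 := 𝕜)
  obtain ⟨φ₀, hφ⟩ := exists_hasExpansion hH
  choose k hk hk0 hkH using b.exists_slidingH_dilate (𝕜 := 𝕜)
  obtain ⟨φ, rfl, hφ0⟩ := hφ.exists_eq_X_sq_mul (b.heavyPoly 𝕜) k hk hk0 hkH
  obtain ⟨π, hπ⟩ := exists_hasExpansion hP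
  obtain ⟨κ, hκ⟩ := exists_hasExpansion hQ
  have hκ0 : κ ≠ 0 := hκ.ne_zero_of_not_eventually hQ fun h => hQ0 (h.mono fun _ => not_not.2)
  have hF₁ := hasExpansion_polyFun (polyF₁ 𝕜)
  have hF₂ := hasExpansion_polyFun (polyF₂ 𝕜)
  rw [scalePoly_polyF₁] at hF₁
  rw [scalePoly_polyF₂] at hF₂
  rw [← polyFun_polyF₁, ← polyFun_polyF₂] at hFind
  obtain ⟨σ, hσ⟩ := exists_quotientMinor_not_eventually_zero hD0 hFind hP hQ hQ0 hPQ
  -- The leading coefficient of the sliding Hamiltonian is `H₂`, so the leading part of its rescaled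
  -- field is the heavy top.
  have hcc : ∀ i, PowerSeries.constantCoeff (formalField φ i) = b.heavyVec 𝕜 i := fun i => by
    rw [formalField, map_hamVec, Body.heavyVec]
    simp only [PowerSeries.constantCoeff_C, constantCoeff_coeffwise, hφ0]
  have hsum : ∀ (n : ℕ) (ψ : PowerSeries (MvPolynomial Idx 𝕜)),
      ∑ i, formalField φ i * coeffwise (MvPolynomial.pderiv (R := 𝕜) i) ψ = 0 →
      ∑ i, formalField φ i
        * coeffwise (MvPolynomial.pderiv (R := 𝕜) i) (PowerSeries.X ^ n * ψ) = 0 := by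
    intro n ψ h
    rw [← mul_zero (PowerSeries.X ^ n), ← h, Finset.mul_sum]
    exact Finset.sum_congr rfl fun i _ => by rw [coeffwise_X_pow_mul]; ring
  obtain ⟨p, q, hq, hpq, hind⟩ := exists_rational_first_integral (PowerSeries.X ^ 2 * φ) φ π κ
    (polyF₁ 𝕜) (polyF₂ 𝕜) (formalField φ) σ rfl hφ.eulerDerivation_eq_zero
    hF₁.eulerDerivation_eq_zero hF₂.eulerDerivation_eq_zero hπ.eulerDerivation_eq_zero
    hκ.eulerDerivation_eq_zero (hsum 2 φ (sum_formalField_mul_self φ))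
    (hsum 4 _ (sum_formalField_mul_F₁ φ)) (hsum 3 _ (sum_formalField_mul_F₂ φ))
    (sum_formalField_mul_quotient_eq_zero hH hP hQ hφ hπ hκ hκ0
      (eventually_first_integral_eq_zero hD0 hFint hP hQ hPQ)) hκ0
    (formal_minor_ne_zero hH (analyticAt_polyFun _ 0) (analyticAt_polyFun _ 0) hP hQ hφ hF₁ hF₂
      hπ hκ hσ)
    (hφ0 ▸ exists_minor_gradients_ne_zero _ b.transpose_inv_inertiaK
      ((Matrix.isUnit_nonsing_inv_det_iff).2 b.isUnit_det_inertiaK) _)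
  simp only [hcc, hφ0] at hpq hind
  rw [← b.polyFun_heavyPoly]
  exact isIntegrableOn_of_rational b.coords_heavyField hq hpq hind
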